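/- **Setting.** Fix positive constants $B,x_{\max},a_{\min},a_{\max},b_{\max},\lambda,\kappa_1,\kappa_2$, a fairness level $\delta\ge 0$ and $\sigma\ge 0$. In round $t=1,2,\dots$ a buyer arrives with features $x_t\in\mathbb R^d$ and a private group $G_t\in\{0,1\}$; the rounds are independent. The features are i.i.d. with $\mathbb E x_t=0$, $\|x_t\|_2\le x_{\max}$ a.s. and $\lambda_{\min}(\mathbb E x_tx_t^\top)\ge\lambda$. The group satisfies $\mathbb P(G_t=0)=q\in(0,1)$ and is independent of the rest of the round. At price $p$ a buyer of group $j$ has demand $y=\alpha_jp+\beta_j^\top\tilde x_t+\epsilon_t$, $\tilde x=(1,x^\top)^\top$, where $\theta_j=(\alpha_j,\beta_j)$ lies in $$\Theta=\{(\alpha,\beta):\ \alpha<0,\ a_{\min}\le|\alpha|\le a_{\max},\ \|\beta\|_1\le b_{\max}\},$$ and $\epsilon_t$ is i.i.d. and $\sigma^2$-sub-Gaussian with conditional mean $0$ given the features and the exploration price of the round. Put $R_j(p,x)=p(\alpha_jp+\beta_j^\top\tilde x)$, let $(p_0^*(x),p_1^*(x))$ maximize $qR_0(p_0,x)+(1-q)R_1(p_1,x)$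 subject to $p_0-p_1\le\delta$, and let $g(x)=\frac{\beta_1^\top\tilde x}{2\alpha_1}-\frac{\beta_0^\top\tilde x}{2\alpha_0}$ be the difference of the unconstrained optimal prices. Assume $\mathbb P(0<\delta-g(x_t)\le r)=o(1/\log(1/r))$ as $r\downarrow 0$. **Policy.** For horizon $T$ put $T_0=\lceil\tau\sqrt T\rceil$, where $\kappa_1\sqrt{\frac{d+2}{q(1-q)}}\le\tau\le\kappa_2\sqrt{\frac{d+2}{q(1-q)}}$, and let $c_\delta\ge 0$. In rounds $t\le T_0$ the seller posts $p_t\sim\mathrm{Unif}(0,B)$, independent of $x_t$, buyers report truthfully, and $(x_t,G_t,p_t)$ is published. Then, for $j=0,1$, $(\hat\alpha_j,\hat\beta_j)$ is a (measurable) minimizer over $\Theta$ of $\sum_{t\le T_0,\,G_t=j}(y_t-\alpha p_t-\beta^\top\tilde x_t)^2$. With $\hat g$ the plug-in version of $g$, the exploitation price function is $p_j(x)=-\frac{\hat\beta_j^\top\tilde x}{2\hat\alpha_j}$ if $\hat g(x)\le\delta-c_\delta\sqrt{\log T_0/T_0}$, and otherwise $$p_j(x)=-\frac{(q\hat\beta_0+(1-q)\hat\beta_1)^\top\tilde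 x}{2q\hat\alpha_0+2(1-q)\hat\alpha_1}-\delta j+\frac{(1-q)\hat\alpha_1\delta}{q\hat\alpha_0+(1-q)\hat\alpha_1}.$$ In a round $t>T_0$ the buyer learns prices $\hat p_0,\hat p_1$ from the $t-1$ published records by a (possibly randomized) regression oracle. A buyer of group $0$ reports group $1$ if $\hat p_0(x_t)-\hat p_1(x_t)>C_0$ and group $0$ otherwise; group $1$ reports truthfully. The offered price is $p_{G'_t}(x_t)$, where $G'_t$ is the report, and $(x_t,G'_t,p_t)$ is published. Here $\delta<C_0$. **Oracle guarantee.** There are $\eta_t\in(0,1)$ and $\mathcal E(t)\to 0$, $t\ge 0$, such that for all $T$, all $T_0<t\le T$ and $j=0,1$, with probability at least $1-\eta_{t-1}$, $|\hat p_j(x_t)-p_j(x_t)|\le\mathcal E(t-1)$. **Theorem.** There are positive constants $c_2,c_3,c_4,c_5$, depending only on $B,x_{\max},a_{\min},a_{\max},b_{\max},\lambda,\sigma,\delta,\kappa_1,\kappa_2$ (in particular not on $d$ and $q$), such that for every instance as above there is $c_1>0$ such that for all $T>c_1$ the regret is well defined (its terms are integrable) and $$\mathrm{Regret}_T=\sum_{t=1}^T\mathbb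 E\big\{q[R_0(p_0^*(x_t),x_t)-R_0(p_{0t},x_t)]+(1-q)[R_1(p_1^*(x_t),x_t)-R_1(p_{1t},x_t)]\big\}<\sqrt{\frac{c_2(d+2)+c_3}{q(1-q)}\,T}+(c_4+c_5q)H(T),$$ where $H(T)=\sum_{t=1}^T\eta_{t-1}$ and $p_{jt}$ is the price that a buyer of true group $j$ is offered in round $t$ (after a possible misreport). -/

import Mathlib

open MeasureTheory ProbabilityTheory Filter Topology
open scoped NNReal

universe u v

noncomputable section

namespace FairPricing

/-- Feature vectors `x ∈ ℝ^d`, with the Euclidean norm. -/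
abbrev Feature (d : ℕ) : Type := EuclideanSpace ℝ (Fin d)

/-- Demand parameters `θ = (α, β)` of one group, `α ∈ ℝ` and `β ∈ ℝ^(d+1)`. -/
abbrev Param (d : ℕ) : Type := ℝ × (Fin (d + 1) → ℝ)

/-- `βᵀ x̃` with `x̃ = (1, x)`. -/
def lin {d : ℕ} (β : Fin (d + 1) → ℝ) (x : Feature d) : ℝ :=
  β 0 + ∑ k : Fin d, β k.succ * x k

/-- Expected revenue `R(p, x) = p (α p + βᵀ x̃)` from one group. -/
def revenue {d : ℕ} (θ : Param d) (p : ℝ) (x : Feature d) : ℝ :=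
  p * (θ.1 * p + lin θ.2 x)

/-- Weighted revenue `q R₀(p₀, x) + (1 - q) R₁(p₁, x)`. -/
def weightedRevenue {d : ℕ} (q : ℝ) (θ : Fin 2 → Param d) (p : Fin 2 → ℝ) (x : Feature d) : ℝ :=
  q * revenue (θ 0) (p 0) x + (1 - q) * revenue (θ 1) (p 1) x

/-- `p = (p₀, p₁)` maximizes the weighted revenue subject to `p₀ - p₁ ≤ δ`: the prices of the
fairness-aware clairvoyant seller for the feature vector `x`. -/
def IsFairOptimal {d : ℕ} (q δ : ℝ) (θ : Fin 2 → Param d) (x : Feature d) (p : Fin 2 → ℝ) : Prop :=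
  p 0 - p 1 ≤ δ ∧
    ∀ p' : Fin 2 → ℝ, p' 0 - p' 1 ≤ δ → weightedRevenue q θ p' x ≤ weightedRevenue q θ p x

/-- The difference `β₁ᵀx̃ / (2α₁) - β₀ᵀx̃ / (2α₀)` of the two unconstrained optimal prices. -/
def gap {d : ℕ} (θ : Fin 2 → Param d) (x : Feature d) : ℝ :=
  lin (θ 1).2 x / (2 * (θ 1).1) - lin (θ 0).2 x / (2 * (θ 0).1)

/-- The price for reported group `j` and features `x` in the exploitation phase, computed from
parameters `θ` (the estimates), where `m` is the safety margin `c_δ √(log T₀ / T₀)`. -/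
def fairPrice {d : ℕ} (q δ m : ℝ) (θ : Fin 2 → Param d) (j : Fin 2) (x : Feature d) : ℝ :=
  if gap θ x ≤ δ - m then
    -(lin (θ j).2 x / (2 * (θ j).1))
  else
    -((q * lin (θ 0).2 x + (1 - q) * lin (θ 1).2 x)
        / (2 * q * (θ 0).1 + 2 * (1 - q) * (θ 1).1))
      - δ * (if j = 1 then 1 else 0)
      + (1 - q) * (θ 1).1 * δ / (q * (θ 0).1 + (1 - q) * (θ 1).1)

/-- The parameter set: `α < 0`, `a_min ≤ |α| ≤ a_max` and `‖β‖₁ ≤ b_max`. -/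
def paramSet (d : ℕ) (amin amax bmax : ℝ) : Set (Param d) :=
  {θ | θ.1 < 0 ∧ amin ≤ |θ.1| ∧ |θ.1| ≤ amax ∧ ∑ k, |θ.2 k| ≤ bmax}

/-- One observation of the seller: features, group, price and demand. -/
abbrev Obs (d : ℕ) : Type := Feature d × Fin 2 × ℝ × ℝ

/-- One public record: features, reported group and price. -/
abbrev Rec (d : ℕ) : Type := Feature d × Fin 2 × ℝ

/-- The sum of squared residuals over the observations of group `j`. -/
def sqLoss {d n : ℕ} (data : Fin n → Obs d) (j : Fin 2) (θ : Param d) : ℝ :=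
  ∑ i, if (data i).2.1 = j then
    ((data i).2.2.2 - θ.1 * (data i).2.2.1 - lin θ.2 (data i).1) ^ 2 else 0

/-- `est` is a least squares estimator over the parameter set `S`: a measurable function of the
data that returns, for every data set and for each group, a minimizer over `S` of the sum of
squared residuals of that group. -/
def IsLeastSquares {d : ℕ} (S : Set (Param d))
    (est : (n : ℕ) → (Fin n → Obs d) → Fin 2 → Param d) : Prop :=
  (∀ n j, Measurable fun data => est n data j) ∧
    ∀ n (data : Fin n → Obs d) j, est n data j ∈ S ∧
      ∀ θ ∈ S, sqLoss data j (est n data j) ≤ sqLoss data j θ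

/-- The group reported by a buyer of true group `g` with features `x` who has learned the prices
`phat`: only group `0` manipulates, and does so when the learned difference exceeds `C₀`. -/
def report {d : ℕ} (C₀ : ℝ) (phat : Fin 2 → Feature d → ℝ) (x : Feature d) (g : Fin 2) : Fin 2 :=
  if g = 0 ∧ C₀ < phat 0 x - phat 1 x then 1 else g

/-- The market. Round `i` (the first one is `i = 0`) has features `X i`, true group `G i`, demand
noise `noise i`; `U i` is the price that the seller posts if round `i` is an exploration round. -/
structure Market (d : ℕ) (Ω : Type u) where
  /-- proportion of group `0` -/
  q : ℝ
  /-- fairness level -/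
  δ : ℝ
  /-- manipulation cost -/
  C₀ : ℝ
  /-- true demand parameters of the two groups -/
  θ : Fin 2 → Param d
  X : ℕ → Ω → Feature d
  G : ℕ → Ω → Fin 2
  U : ℕ → Ω → ℝ
  noise : ℕ → Ω → ℝ

/-- How buyers learn prices: an offline regression oracle, which turns `n` public records and the
internal randomness of the procedure into predicted prices `phat j x`, and that randomness
(`seed i` is used by the buyer of round `i`). -/
structure Learner (d : ℕ) (Ω : Type u) (Z : Type v) where
  oracle : (n : ℕ) → (Fin n → Rec d) → Z → Fin 2 → Feature d → ℝ
  seed : ℕ → Ω → Z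

/-- The inputs of the seller's policy. -/
structure Policy (d : ℕ) where
  τ : ℝ
  cδ : ℝ
  est : (n : ℕ) → (Fin n → Obs d) → Fin 2 → Param d

/-- Length `T₀ = τ √T` of the exploration phase (rounded up). -/
def Policy.T₀ {d : ℕ} (π : Policy d) (T : ℕ) : ℕ := ⌈π.τ * √(T : ℝ)⌉₊

section Model

variable {d : ℕ} {Ω : Type u} {Z : Type v}

/-- Data of the first `n` rounds when these are exploration rounds; the demand is
`y = α p + βᵀx̃ + ε` with the parameters of the true group. -/
def Market.exploreData (M : Market d Ω) (n : ℕ) (ω : Ω) : Fin n → Obs d := fun i =>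
  (M.X i ω, M.G i ω, M.U i ω,
    (M.θ (M.G i ω)).1 * M.U i ω + lin (M.θ (M.G i ω)).2 (M.X i ω) + M.noise i ω)

/-- The parameter estimates at the end of the exploration phase. -/
def Policy.thetaHat (π : Policy d) (M : Market d Ω) (T : ℕ) (ω : Ω) : Fin 2 → Param d :=
  π.est (π.T₀ T) (M.exploreData (π.T₀ T) ω)

/-- The seller's price function `p_j(x)` in the exploitation phase, for horizon `T`. -/
def Policy.price (π : Policy d) (M : Market d Ω) (T : ℕ) (ω : Ω) (j : Fin 2) (x : Feature d) : ℝ :=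
  fairPrice M.q M.δ (π.cδ * √(Real.log (π.T₀ T) / (π.T₀ T : ℝ))) (π.thetaHat M T ω) j x

/-- The first `n` public records, for horizon `T`. -/
def history (M : Market d Ω) (π : Policy d) (L : Learner d Ω Z) (T : ℕ) (ω : Ω) :
    (n : ℕ) → Fin n → Rec d
  | 0 => Fin.elim0
  | n + 1 =>
    let h : Fin n → Rec d := history M π L T ω n
    let g : Fin 2 := report M.C₀ (L.oracle n h (L.seed n ω)) (M.X n ω) (M.G n ω)
    Fin.snoc (α := fun _ => Rec d) h
      (if n < π.T₀ T then (M.X n ω, M.G n ω, M.U n ω)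
        else (M.X n ω, g, π.price M T ω g (M.X n ω)))

/-- The prices learned by the buyer of round `i` from the `i` earlier public records. -/
def learned (M : Market d Ω) (π : Policy d) (L : Learner d Ω Z) (T i : ℕ) (ω : Ω) :
    Fin 2 → Feature d → ℝ :=
  L.oracle i (history M π L T ω i) (L.seed i ω)

/-- The price that a buyer whose true group is `j` is offered in round `i`. -/
def offered (M : Market d Ω) (π : Policy d) (L : Learner d Ω Z) (T i : ℕ) (ω : Ω) (j : Fin 2) : ℝ :=
  if i < π.T₀ T then M.U i ω
  else π.price M T ω (report M.C₀ (learned M π L T i ω) (M.X i ω) j) (M.X i ω)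

/-- The instantaneous regret of round `i` against the clairvoyant prices `pstar`. -/
def instRegret (M : Market d Ω) (π : Policy d) (L : Learner d Ω Z) (pstar : Feature d → Fin 2 → ℝ)
    (T i : ℕ) (ω : Ω) : ℝ :=
  M.q * (revenue (M.θ 0) (pstar (M.X i ω) 0) (M.X i ω)
      - revenue (M.θ 0) (offered M π L T i ω 0) (M.X i ω))
    + (1 - M.q) * (revenue (M.θ 1) (pstar (M.X i ω) 1) (M.X i ω)
      - revenue (M.θ 1) (offered M π L T i ω 1) (M.X i ω))

/-- The cumulative expected regret over the horizon `T`. -/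
def regret [MeasurableSpace Ω] (μ : Measure Ω) (M : Market d Ω) (π : Policy d) (L : Learner d Ω Z)
    (pstar : Feature d → Fin 2 → ℝ) (T : ℕ) : ℝ :=
  ∑ i ∈ Finset.range T, ∫ ω, instRegret M π L pstar T i ω ∂μ

/-- The second-moment matrix `E[x xᵀ]` of the features. -/
def Market.secondMoment [MeasurableSpace Ω] (μ : Measure Ω) (M : Market d Ω) :
    Matrix (Fin d) (Fin d) ℝ :=
  Matrix.of fun k l => ∫ ω, M.X 0 ω k * M.X 0 ω l ∂μ

/-- The probabilistic model: independent rounds; i.i.d. centred features; group `0` has probability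
`q`, and the group is independent of the rest of the round; exploration prices are uniform on
`(0, B)` and independent of the features; the noise is i.i.d., `σ²`-sub-Gaussian and has conditional
mean zero given features and price. -/
structure Market.Model [MeasurableSpace Ω] (μ : Measure Ω) (M : Market d Ω) (B : ℝ) (σ : ℝ≥0) :
    Prop where
  q_mem : M.q ∈ Set.Ioo (0 : ℝ) 1
  measurable_X : ∀ i, Measurable (M.X i)
  measurable_G : ∀ i, Measurable (M.G i)
  measurable_U : ∀ i, Measurable (M.U i)
  measurable_noise : ∀ i, Measurable (M.noise i)
  indep_rounds : iIndepFun (fun i ω => (M.X i ω, M.G i ω, M.U i ω, M.noise i ω)) μ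
  indep_group : ∀ i, IndepFun (M.G i) (fun ω => (M.X i ω, M.U i ω, M.noise i ω)) μ
  indep_price : ∀ i, IndepFun (M.X i) (M.U i) μ
  ident_X : ∀ i, IdentDistrib (M.X i) (M.X 0) μ μ
  mean_X : ∫ ω, M.X 0 ω ∂μ = 0
  prob_G : ∀ i, μ.real {ω | M.G i ω = 0} = M.q
  uniform_U : ∀ i, pdf.IsUniform (M.U i) (Set.Ioo 0 B) μ volume
  ident_noise : ∀ i, IdentDistrib (M.noise i) (M.noise 0) μ μ
  subgaussian : ∀ i, HasSubgaussianMGF (M.noise i) (σ ^ 2) μ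
  noise_mean : ∀ i, μ[M.noise i | MeasurableSpace.comap (fun ω => (M.X i ω, M.U i ω))
    inferInstance] =ᵐ[μ] 0

/-- Bounded features and demand parameters. -/
structure Market.Bounded [MeasurableSpace Ω] (μ : Measure Ω) (M : Market d Ω)
    (xmax amin amax bmax : ℝ) : Prop where
  features : ∀ i, ∀ᵐ ω ∂μ, ‖M.X i ω‖ ≤ xmax
  params : ∀ j, M.θ j ∈ paramSet d amin amax bmax

/-- No perfectly collinear features: the least eigenvalue of the (symmetric) second-moment matrix is
at least `lam`. -/
def Market.EigenBound [MeasurableSpace Ω] (μ : Measure Ω) (M : Market d Ω) (lam : ℝ) : Prop :=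
  ∀ w : Fin d → ℝ, lam * (w ⬝ᵥ w) ≤ w ⬝ᵥ (M.secondMoment μ).mulVec w

/-- The unconstrained price difference does not concentrate just below the fairness level: with
`g` the unconstrained difference at the features, `P(0 < δ - g ≤ r) = o(1 / log (1 / r))`
as `r` decreases to `0`. -/
def Market.BoundaryRegular [MeasurableSpace Ω] (μ : Measure Ω) (M : Market d Ω) : Prop :=
  Tendsto (fun r : ℝ => Real.log (1 / r) *
      μ.real {ω | 0 < M.δ - gap M.θ (M.X 0 ω) ∧ M.δ - gap M.θ (M.X 0 ω) ≤ r})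
    (𝓝[>] 0) (𝓝 0)

/-- The oracle and its randomness are measurable. -/
structure Learner.IsMeasurable [MeasurableSpace Ω] [MeasurableSpace Z] (L : Learner d Ω Z) :
    Prop where
  oracle : ∀ n j, Measurable
    fun a : (Fin n → Rec d) × Z × Feature d => L.oracle n a.1 a.2.1 j a.2.2
  seed : ∀ i, Measurable (L.seed i)

/-- The offline regression guarantee: from `i` samples, the price function of each group is learned
at the features of the arriving buyer up to an error `err i`, with probability at least `1 - η i`;
the confidence levels lie in `(0, 1)` and the error bound tends to `0`. -/
structure Learner.Guarantee [MeasurableSpace Ω] (μ : Measure Ω) (L : Learner d Ω Z)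
    (M : Market d Ω) (π : Policy d) (η err : ℕ → ℝ) : Prop where
  level : ∀ i, η i ∈ Set.Ioo (0 : ℝ) 1
  err_tendsto : Tendsto err atTop (𝓝 0)
  accuracy : ∀ T i : ℕ, π.T₀ T ≤ i → i < T → ∀ j : Fin 2,
    1 - η i ≤ μ.real {ω |
      |learned M π L T i ω j (M.X i ω) - π.price M T ω j (M.X i ω)| ≤ err i}

end Model

end FairPricing

end

/-! Write `n` for the length of the exploration phase, `w = q (1 - q)` and `D = √((d + 2) / w)`. The
regret of a round is bounded, so exploration costs `O(n)`. An exploitation round has three sources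
of loss, and their sum is `O(1 / (n w))` plus a multiple of `q η`. Since `n` is of order `D √T` and
`1 / w ≤ D²`, both `n` and `T / (n w)` are `O(D √T)`.

Estimation error. Each revenue is a concave parabola, so a price loses the slope times its squared
distance to the monopoly price. Tied prices obey a similar identity (`weighted_sq_tied`), hence the
loss of plug-in prices is quadratic in the parameter error (`weightedRevenue_fairPrice_sub_le`). The
mean squared error is `O(1 / (n P(G = j)))` (`Market.EigenBound.integral_paramDist_le`). No matrix
concentration is needed. The basic inequality of least squares compares the error `v` with the score
and with the deviation of the Gram matrix from its mean. The mean is at least `n P(G = j) c` times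
the identity, and `|v|` is bounded because the estimator is constrained, so Cauchy-Schwarz and
second moments suffice (`sq_mul_sum_sq_le`). The regression vector has bounded norm, so no factor
`d` appears there.

Safety margin. If `δ - g(x)` exceeds twice the margin `m`, tying the prices wrongly requires an
estimation error comparable to `δ - g(x)`. For the remaining `x` with `0 < δ - g(x) ≤ 2m` the extra
loss is `O(m²)`. As `m² n = c² log n` with `c` the factor of the margin, and these `x` have
probability `o(1 / log (1 / m))`, the contribution is `o(1 / n)`
(`Market.BoundaryRegular.eventually_margin`).

Misreports. Posted prices never differ by more than `δ < C₀`, so a misreport forces an error above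
`(C₀ - δ) / 2` in a learned price. Once the accuracy of the oracle is below this level the
probability is at most `2 η` (`measureReal_misreport_le`), and only the revenue from group `0`, of
weight `q`, is affected. -/

namespace FairPricing

/-! ### Linear demand -/

/-- The feature vector augmented by an intercept. -/
def augment {d : ℕ} (x : Feature d) : Fin (d + 1) → ℝ := Fin.cons 1 x

/-- Squared Euclidean distance of two parameters. -/
def paramDist {d : ℕ} (θ θ' : Param d) : ℝ :=
  (θ.1 - θ'.1) ^ 2 + ∑ k, (θ.2 k - θ'.2 k) ^ 2

theorem paramDist_nonneg {d : ℕ} (θ θ' : Param d) : 0 ≤ paramDist θ θ' := by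
  unfold paramDist; positivity

theorem lin_eq_sum {d : ℕ} (β : Fin (d + 1) → ℝ) (x : Feature d) :
    lin β x = ∑ k, β k * augment x k := by
  simp [lin, augment, Fin.sum_univ_succ]

theorem sum_augment_sq {d : ℕ} (x : Feature d) : ∑ k, augment x k ^ 2 = 1 + ‖x‖ ^ 2 := by
  simp [augment, Fin.sum_univ_succ, EuclideanSpace.real_norm_sq_eq]

/-- Duality of the `ℓ¹` and `ℓ^∞` norms keeps the bound free of `d`: each coordinate of the
augmented vector is at most `1 + r` in absolute value. -/
theorem abs_lin_le {d : ℕ} {β : Fin (d + 1) → ℝ} {x : Feature d} {b r : ℝ}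
    (hβ : ∑ k, |β k| ≤ b) (hx : ‖x‖ ≤ r) : |lin β x| ≤ b * (1 + r) := by
  have hr : 0 ≤ r := (norm_nonneg x).trans hx
  have haug : ∀ k, |augment x k| ≤ 1 + r := by
    intro k
    refine Fin.cases ?_ (fun k => ?_) k
    · simp [augment, hr]
    · have := (PiLp.norm_apply_le x k).trans hx
      simp only [augment, Fin.cons_succ, Real.norm_eq_abs] at this ⊢
      linarith
  rw [lin_eq_sum]
  calc |∑ k, β k * augment x k| ≤ ∑ k, |β k * augment x k| := Finset.abs_sum_le_sum_abs _ _
    _ ≤ ∑ k, |β k| * (1 + r) := Finset.sum_le_sum fun k _ => by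
        rw [abs_mul]; exact mul_le_mul_of_nonneg_left (haug k) (abs_nonneg _)
    _ = (∑ k, |β k|) * (1 + r) := by rw [Finset.sum_mul]
    _ ≤ b * (1 + r) := by gcongr

theorem lin_sub_sq_le {d : ℕ} (β β' : Fin (d + 1) → ℝ) {x : Feature d} {r : ℝ}
    (hx : ‖x‖ ≤ r) : (lin β x - lin β' x) ^ 2 ≤ (1 + r ^ 2) * ∑ k, (β k - β' k) ^ 2 := by
  have h : lin β x - lin β' x = ∑ k, (β k - β' k) * augment x k := by
    simp [lin_eq_sum, sub_mul]
  have hr : ‖x‖ ^ 2 ≤ r ^ 2 := by gcongr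
  calc (lin β x - lin β' x) ^ 2 ≤ (∑ k, (β k - β' k) ^ 2) * ∑ k, augment x k ^ 2 := by
        rw [h]; exact Finset.sum_mul_sq_le_sq_mul_sq _ _ _
    _ ≤ (∑ k, (β k - β' k) ^ 2) * (1 + r ^ 2) := by
        rw [sum_augment_sq]; gcongr
    _ = _ := mul_comm _ _

theorem slope_mem {d : ℕ} {amin amax bmax : ℝ} {θ : Param d} (h : θ ∈ paramSet d amin amax bmax) :
    θ.1 < 0 ∧ amin ≤ -θ.1 ∧ -θ.1 ≤ amax := by
  obtain ⟨h0, h1, h2, -⟩ := h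
  rw [abs_of_neg h0] at h1 h2
  exact ⟨h0, h1, h2⟩

/-! ### Optimal prices -/

/-- The unconstrained optimal price of a group. -/
noncomputable def monopolyPrice {d : ℕ} (θ : Param d) (x : Feature d) : ℝ := -(lin θ.2 x / (2 * θ.1))

/-- The share of group `1` in the total price sensitivity. -/
noncomputable def slopeShare {d : ℕ} (q : ℝ) (θ : Fin 2 → Param d) : ℝ :=
  (1 - q) * (θ 1).1 / (q * (θ 0).1 + (1 - q) * (θ 1).1)

/-- The optimal price of group `0` when the price difference is tied to `δ`. -/
noncomputable def tiedPrice {d : ℕ} (q δ : ℝ) (θ : Fin 2 → Param d) (x : Feature d) : ℝ :=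
  (1 - slopeShare q θ) * monopolyPrice (θ 0) x
    + slopeShare q θ * (monopolyPrice (θ 1) x + δ)

theorem gap_eq {d : ℕ} (θ : Fin 2 → Param d) (x : Feature d) :
    gap θ x = monopolyPrice (θ 0) x - monopolyPrice (θ 1) x := by
  simp only [gap, monopolyPrice]; ring

/-- Completing the square; from here on all losses are weighted squared distances to monopoly
prices. -/
theorem revenue_eq {d : ℕ} {θ : Param d} (h : θ.1 < 0) (p : ℝ) (x : Feature d) :
    revenue θ p x = θ.1 * (p - monopolyPrice θ x) ^ 2 - θ.1 * monopolyPrice θ x ^ 2 := by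
  have := h.ne
  simp only [revenue, monopolyPrice]
  field_simp
  ring

theorem weighted_slope_neg {d : ℕ} {q : ℝ} (hq : q ∈ Set.Ioo (0 : ℝ) 1) {θ : Fin 2 → Param d}
    (h : ∀ j, (θ j).1 < 0) : q * (θ 0).1 + (1 - q) * (θ 1).1 < 0 := by
  have h0 := mul_neg_of_pos_of_neg hq.1 (h 0)
  have h1 := mul_neg_of_pos_of_neg (sub_pos.2 hq.2) (h 1)
  linarith

theorem slopeShare_mem {d : ℕ} {q : ℝ} (hq : q ∈ Set.Ioo (0 : ℝ) 1) {θ : Fin 2 → Param d}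
    (h : ∀ j, (θ j).1 < 0) : slopeShare q θ ∈ Set.Icc (0 : ℝ) 1 := by
  have hs := weighted_slope_neg hq h
  have h0 := mul_neg_of_pos_of_neg hq.1 (h 0)
  have h1 := mul_neg_of_pos_of_neg (sub_pos.2 hq.2) (h 1)
  refine ⟨div_nonneg_of_nonpos h1.le hs.le, ?_⟩
  rw [slopeShare, div_le_one_of_neg hs]
  linarith

theorem fairPrice_of_gap_le {d : ℕ} {q δ m : ℝ} {θ : Fin 2 → Param d} {x : Feature d}
    (h : gap θ x ≤ δ - m) (j : Fin 2) : fairPrice q δ m θ j x = monopolyPrice (θ j) x := by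
  rw [fairPrice, if_pos h, monopolyPrice]

/-- Dividing by the weighted slope turns the closed formula into a mean of the two monopoly prices
(the second shifted by `δ`) with weights in `[0, 1]`. This form gives bounds that do not depend on
`q`. -/
theorem fairPrice_zero_of_lt_gap {d : ℕ} {q δ m : ℝ} (hq : q ∈ Set.Ioo (0 : ℝ) 1)
    {θ : Fin 2 → Param d} (hθ : ∀ j, (θ j).1 < 0) {x : Feature d} (h : ¬gap θ x ≤ δ - m) :
    fairPrice q δ m θ 0 x = tiedPrice q δ θ x := by
  have hs := (weighted_slope_neg hq hθ).ne
  have h0 := (hθ 0).ne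
  have h1 := (hθ 1).ne
  have e : 2 * q * (θ 0).1 + 2 * (1 - q) * (θ 1).1 = 2 * (q * (θ 0).1 + (1 - q) * (θ 1).1) := by
    ring
  have hcompl : 1 - slopeShare q θ = q * (θ 0).1 / (q * (θ 0).1 + (1 - q) * (θ 1).1) := by
    rw [slopeShare]; field_simp; ring
  rw [fairPrice, if_neg h, tiedPrice, hcompl, slopeShare, monopolyPrice, monopolyPrice, e]
  simp only [Fin.zero_eq_one_iff, Nat.succ_ne_self, if_false]
  generalize hS : q * (θ 0).1 + (1 - q) * (θ 1).1 = S at *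
  field_simp
  ring

theorem fairPrice_one_of_lt_gap {d : ℕ} {q δ m : ℝ} {θ : Fin 2 → Param d} {x : Feature d}
    (h : ¬gap θ x ≤ δ - m) : fairPrice q δ m θ 1 x = fairPrice q δ m θ 0 x - δ := by
  rw [fairPrice, fairPrice, if_neg h, if_neg h]
  simp
  ring

/-- Both branches are fair whatever the parameters are, provided the margin is nonnegative. Used for
the feasibility of the optimal prices and to exclude misreports under accurate learning. -/
theorem fairPrice_sub_le {d : ℕ} {q δ m : ℝ} (hm : 0 ≤ m) (θ : Fin 2 → Param d) (x : Feature d) :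
    fairPrice q δ m θ 0 x - fairPrice q δ m θ 1 x ≤ δ := by
  by_cases h : gap θ x ≤ δ - m
  · rw [fairPrice_of_gap_le h, fairPrice_of_gap_le h, ← gap_eq]; linarith
  · rw [fairPrice_one_of_lt_gap h]; linarith

theorem weightedRevenue_sub {d : ℕ} (q : ℝ) {θ : Fin 2 → Param d} (hθ : ∀ j, (θ j).1 < 0)
    (p p' : Fin 2 → ℝ) (x : Feature d) :
    weightedRevenue q θ p x - weightedRevenue q θ p' x
      = q * (θ 0).1 * ((p 0 - monopolyPrice (θ 0) x) ^ 2 - (p' 0 - monopolyPrice (θ 0) x) ^ 2)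
        + (1 - q) * (θ 1).1
          * ((p 1 - monopolyPrice (θ 1) x) ^ 2 - (p' 1 - monopolyPrice (θ 1) x) ^ 2) := by
  simp only [weightedRevenue, revenue_eq (hθ _)]
  ring

/-- The plug-in price rule without margin is optimal at the true parameters. -/
theorem isFairOptimal_fairPrice {d : ℕ} {q δ : ℝ} (hq : q ∈ Set.Ioo (0 : ℝ) 1)
    {θ : Fin 2 → Param d} (hθ : ∀ j, (θ j).1 < 0) (x : Feature d) :
    IsFairOptimal q δ θ x fun j => fairPrice q δ 0 θ j x := by
  refine ⟨fairPrice_sub_le le_rfl θ x, fun p' hp' => ?_⟩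
  rw [← sub_nonneg, weightedRevenue_sub q hθ]
  have h0 := mul_neg_of_pos_of_neg hq.1 (hθ 0)
  have h1 := mul_neg_of_pos_of_neg (sub_pos.2 hq.2) (hθ 1)
  by_cases h : gap θ x ≤ δ - 0
  · simp only [fairPrice_of_gap_le h]
    nlinarith [mul_nonneg (neg_pos.2 h0).le (sq_nonneg (p' 0 - monopolyPrice (θ 0) x)),
      mul_nonneg (neg_pos.2 h1).le (sq_nonneg (p' 1 - monopolyPrice (θ 1) x))]
  · simp only [fairPrice_one_of_lt_gap h, fairPrice_zero_of_lt_gap hq hθ h, tiedPrice]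
    have hρ := slopeShare_mem hq hθ
    have hs := weighted_slope_neg hq hθ
    have hbal : slopeShare q θ * (q * (θ 0).1) = (1 - slopeShare q θ) * ((1 - q) * (θ 1).1) := by
      have := hs.ne
      rw [slopeShare]; field_simp; ring
    rw [gap_eq, sub_zero, not_le] at h
    generalize slopeShare q θ = ρ at *
    generalize q * (θ 0).1 = w at *
    generalize (1 - q) * (θ 1).1 = v at *
    generalize monopolyPrice (θ 0) x = u0 at *
    generalize monopolyPrice (θ 1) x = u1 at *
    generalize p' 0 = a at *
    generalize p' 1 = b at *
    -- The first-order condition `hbal` removes the cross terms: two squares remain, and a Lagrange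
    -- multiplier times the slack of `p'` in the constraint.
    have key : w * (((1 - ρ) * u0 + ρ * (u1 + δ) - u0) ^ 2 - (a - u0) ^ 2)
        + v * (((1 - ρ) * u0 + ρ * (u1 + δ) - δ - u1) ^ 2 - (b - u1) ^ 2)
        = -w * (a - ((1 - ρ) * u0 + ρ * (u1 + δ))) ^ 2
          - v * (b - ((1 - ρ) * u0 + ρ * (u1 + δ) - δ)) ^ 2
          + 2 * (ρ * (-w)) * ((u0 - u1 - δ) * (δ - (a - b))) := by
      linear_combination (2 * (u0 - u1 - δ) * (b - (1 - ρ) * u0 - ρ * (u1 + δ) + δ)) * hbal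
    rw [key]
    have t1 : 0 ≤ -w * (a - ((1 - ρ) * u0 + ρ * (u1 + δ))) ^ 2 :=
      mul_nonneg (by linarith) (sq_nonneg _)
    have t2 : 0 ≤ -v * (b - ((1 - ρ) * u0 + ρ * (u1 + δ) - δ)) ^ 2 :=
      mul_nonneg (by linarith) (sq_nonneg _)
    have t3 : 0 ≤ 2 * (ρ * (-w)) * ((u0 - u1 - δ) * (δ - (a - b))) :=
      mul_nonneg (mul_nonneg two_pos.le (mul_nonneg hρ.1 (by linarith)))
        (mul_nonneg (by linarith) (by linarith))
    linarith

/-! ### Regret of plug-in prices -/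

theorem abs_monopolyPrice_le {d : ℕ} {amin amax bmax xmax : ℝ} (hamin : 0 < amin) {θ : Param d}
    (h : θ ∈ paramSet d amin amax bmax) {x : Feature d} (hx : ‖x‖ ≤ xmax) :
    |monopolyPrice θ x| ≤ bmax * (1 + xmax) / (2 * amin) := by
  obtain ⟨h0, h1, h2⟩ := slope_mem h
  rw [monopolyPrice, abs_neg, abs_div, abs_mul, abs_two, abs_of_neg h0]
  exact div_le_div₀ ((abs_nonneg _).trans (abs_lin_le h.2.2.2 hx)) (abs_lin_le h.2.2.2 hx)
    (by positivity) (by linarith)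

theorem monopolyPrice_sub_sq_le {d : ℕ} {amin amax bmax xmax : ℝ} (hamin : 0 < amin)
    {θ θ' : Param d} (h : θ ∈ paramSet d amin amax bmax) (h' : θ' ∈ paramSet d amin amax bmax)
    {x : Feature d} (hx : ‖x‖ ≤ xmax) :
    (monopolyPrice θ x - monopolyPrice θ' x) ^ 2
      ≤ ((bmax * (1 + xmax)) ^ 2 / (2 * amin ^ 4) + (1 + xmax ^ 2) / (2 * amin ^ 2))
        * paramDist θ θ' := by
  obtain ⟨h0, h1, h2⟩ := slope_mem h
  obtain ⟨h0', h1', h2'⟩ := slope_mem h'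
  have hl := abs_lin_le h'.2.2.2 hx
  have hd := lin_sub_sq_le θ.2 θ'.2 hx
  set S := ∑ k, (θ.2 k - θ'.2 k) ^ 2
  have hS : 0 ≤ S := Finset.sum_nonneg fun _ _ => sq_nonneg _
  -- Change the slope first and the linear part afterwards.
  have e : monopolyPrice θ x - monopolyPrice θ' x
      = lin θ'.2 x * (θ.1 - θ'.1) / (2 * (θ.1 * θ'.1)) + -((lin θ.2 x - lin θ'.2 x) / (2 * θ.1)) := by
    have := h0.ne
    have := h0'.ne
    simp only [monopolyPrice]
    field_simp
    ring
  have hsq : amin ^ 2 ≤ θ.1 ^ 2 := neg_sq θ.1 ▸ pow_le_pow_left₀ hamin.le h1 2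
  have hsq' : amin ^ 2 ≤ θ'.1 ^ 2 := neg_sq θ'.1 ▸ pow_le_pow_left₀ hamin.le h1' 2
  have b1 : (lin θ'.2 x * (θ.1 - θ'.1) / (2 * (θ.1 * θ'.1))) ^ 2
      ≤ (bmax * (1 + xmax)) ^ 2 * (θ.1 - θ'.1) ^ 2 / (4 * amin ^ 4) := by
    rw [div_pow, mul_pow]
    refine div_le_div₀ (by positivity)
      (mul_le_mul_of_nonneg_right (sq_le_sq' (abs_le.1 hl).1 (abs_le.1 hl).2) (sq_nonneg _))
      (by positivity) ?_
    linarith [mul_le_mul hsq hsq' (sq_nonneg amin) (sq_nonneg _)]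
  have b2 : ((lin θ.2 x - lin θ'.2 x) / (2 * θ.1)) ^ 2 ≤ (1 + xmax ^ 2) * S / (4 * amin ^ 2) := by
    rw [div_pow]
    exact div_le_div₀ (by positivity) hd (by positivity) (by linarith)
  have b3 : (monopolyPrice θ x - monopolyPrice θ' x) ^ 2
      ≤ 2 * ((bmax * (1 + xmax)) ^ 2 * (θ.1 - θ'.1) ^ 2 / (4 * amin ^ 4)
        + (1 + xmax ^ 2) * S / (4 * amin ^ 2)) := by
    rw [e]
    refine add_sq_le.trans ?_
    rw [neg_sq]
    gcongr
  have c1 : 0 ≤ (bmax * (1 + xmax)) ^ 2 / (2 * amin ^ 4) * S := by positivity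
  have c2 : 0 ≤ (1 + xmax ^ 2) / (2 * amin ^ 2) * (θ.1 - θ'.1) ^ 2 := by positivity
  calc _ ≤ _ := b3
    _ = (bmax * (1 + xmax)) ^ 2 / (2 * amin ^ 4) * (θ.1 - θ'.1) ^ 2
        + (1 + xmax ^ 2) / (2 * amin ^ 2) * S := by ring
    _ ≤ _ := by rw [paramDist]; linarith

theorem weighted_slope_mem {d : ℕ} {q amin amax bmax : ℝ} (hq : q ∈ Set.Ioo (0 : ℝ) 1)
    {θ : Fin 2 → Param d} (h : ∀ j, θ j ∈ paramSet d amin amax bmax) :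
    amin ≤ -(q * (θ 0).1 + (1 - q) * (θ 1).1) ∧ -(q * (θ 0).1 + (1 - q) * (θ 1).1) ≤ amax := by
  obtain ⟨-, h1, h2⟩ := slope_mem (h 0)
  obtain ⟨-, h3, h4⟩ := slope_mem (h 1)
  obtain ⟨hq0, hq1⟩ := hq
  constructor <;> nlinarith

/-- The weighted slopes are means of slopes, so both denominators are at least `amin` in absolute
value for every `q`; the numerator is bilinear in the slopes with the harmless factor `q (1 - q)`.
-/
theorem slopeShare_sub_sq_le {d : ℕ} {q amin amax bmax : ℝ} (hq : q ∈ Set.Ioo (0 : ℝ) 1)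
    (hamin : 0 < amin) {θ θ' : Fin 2 → Param d} (h : ∀ j, θ j ∈ paramSet d amin amax bmax)
    (h' : ∀ j, θ' j ∈ paramSet d amin amax bmax) :
    (slopeShare q θ - slopeShare q θ') ^ 2
      ≤ 2 * amax ^ 2 / amin ^ 4 * (paramDist (θ 0) (θ' 0) + paramDist (θ 1) (θ' 1)) := by
  have hs := (weighted_slope_mem hq h).1
  have hs' := (weighted_slope_mem hq h').1
  obtain ⟨hn0, -, hx0⟩ := slope_mem (h' 0)
  obtain ⟨hn1, -, hx1⟩ := slope_mem (h' 1)
  have hd : ∀ j, ((θ j).1 - (θ' j).1) ^ 2 ≤ paramDist (θ j) (θ' j) := fun j => by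
    rw [paramDist]
    exact le_add_of_nonneg_right (Finset.sum_nonneg fun _ _ => sq_nonneg _)
  have hne : q * (θ 0).1 + (1 - q) * (θ 1).1 ≠ 0 := by intro h0; rw [h0] at hs; linarith
  have hne' : q * (θ' 0).1 + (1 - q) * (θ' 1).1 ≠ 0 := by intro h0; rw [h0] at hs'; linarith
  have e : slopeShare q θ - slopeShare q θ'
      = q * (1 - q) * ((θ' 0).1 * ((θ 1).1 - (θ' 1).1) + -((θ' 1).1 * ((θ 0).1 - (θ' 0).1)))
        / ((q * (θ 0).1 + (1 - q) * (θ 1).1) * (q * (θ' 0).1 + (1 - q) * (θ' 1).1)) := by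
    rw [slopeShare, slopeShare, div_sub_div _ _ hne hne']
    congr 1
    ring
  have n1 : ((θ' 0).1 * ((θ 1).1 - (θ' 1).1) + -((θ' 1).1 * ((θ 0).1 - (θ' 0).1))) ^ 2
      ≤ 2 * amax ^ 2 * (paramDist (θ 0) (θ' 0) + paramDist (θ 1) (θ' 1)) := by
    refine add_sq_le.trans ?_
    rw [neg_sq, mul_pow, mul_pow]
    have ha : (θ' 0).1 ^ 2 ≤ amax ^ 2 :=
      neg_sq (θ' 0).1 ▸ pow_le_pow_left₀ (neg_pos.2 hn0).le hx0 2
    have ha' : (θ' 1).1 ^ 2 ≤ amax ^ 2 :=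
      neg_sq (θ' 1).1 ▸ pow_le_pow_left₀ (neg_pos.2 hn1).le hx1 2
    linarith [mul_le_mul ha (hd 1) (sq_nonneg _) (sq_nonneg _),
      mul_le_mul ha' (hd 0) (sq_nonneg _) (sq_nonneg _)]
  have hqq : (q * (1 - q)) ^ 2 ≤ 1 := by
    have h0 := mul_pos hq.1 (sub_pos.2 hq.2)
    exact pow_le_one₀ h0.le (mul_le_one₀ hq.2.le (sub_pos.2 hq.2).le (sub_le_self 1 hq.1.le))
  have hden : amin ^ 4 ≤ ((q * (θ 0).1 + (1 - q) * (θ 1).1)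
      * (q * (θ' 0).1 + (1 - q) * (θ' 1).1)) ^ 2 := by
    rw [mul_pow, show amin ^ 4 = amin ^ 2 * amin ^ 2 by ring]
    exact mul_le_mul (neg_sq (q * (θ 0).1 + (1 - q) * (θ 1).1) ▸ pow_le_pow_left₀ hamin.le hs 2)
      (neg_sq (q * (θ' 0).1 + (1 - q) * (θ' 1).1) ▸ pow_le_pow_left₀ hamin.le hs' 2)
      (sq_nonneg _) (sq_nonneg _)
  have hN : 0 ≤ paramDist (θ 0) (θ' 0) + paramDist (θ 1) (θ' 1) :=
    add_nonneg (paramDist_nonneg _ _) (paramDist_nonneg _ _)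
  rw [e, div_pow, mul_pow, div_mul_eq_mul_div]
  refine div_le_div₀ (by positivity) ?_ (by positivity) hden
  calc _ ≤ 1 * _ := mul_le_mul_of_nonneg_right hqq (sq_nonneg _)
    _ ≤ _ := by rw [one_mul]; exact n1

theorem tiedPrice_sub_sq_le {d : ℕ} {q δ amin amax bmax xmax : ℝ} (hq : q ∈ Set.Ioo (0 : ℝ) 1)
    (hδ : 0 ≤ δ) (hamin : 0 < amin) {θ θ' : Fin 2 → Param d}
    (h : ∀ j, θ j ∈ paramSet d amin amax bmax) (h' : ∀ j, θ' j ∈ paramSet d amin amax bmax)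
    {x : Feature d} (hx : ‖x‖ ≤ xmax) :
    (tiedPrice q δ θ' x - tiedPrice q δ θ x) ^ 2
      ≤ 2 * ((monopolyPrice (θ' 0) x - monopolyPrice (θ 0) x) ^ 2
          + (monopolyPrice (θ' 1) x - monopolyPrice (θ 1) x) ^ 2)
        + 2 * (bmax * (1 + xmax) / amin + δ) ^ 2 * (slopeShare q θ' - slopeShare q θ) ^ 2 := by
  have hρ := slopeShare_mem hq fun j => (slope_mem (h' j)).1
  have b0 := abs_le.1 (abs_monopolyPrice_le hamin (h 0) hx)
  have b1 := abs_le.1 (abs_monopolyPrice_le hamin (h 1) hx)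
  have eU : bmax * (1 + xmax) / amin = 2 * (bmax * (1 + xmax) / (2 * amin)) := by
    field_simp
  rw [eU]
  simp only [tiedPrice]
  generalize bmax * (1 + xmax) / (2 * amin) = C at *
  generalize slopeShare q θ' = ρ' at *
  generalize slopeShare q θ = ρ at *
  generalize monopolyPrice (θ 0) x = u0 at *
  generalize monopolyPrice (θ 1) x = u1 at *
  generalize monopolyPrice (θ' 0) x = v0 at *
  generalize monopolyPrice (θ' 1) x = v1 at *
  -- Separate the error in the monopoly prices, averaged with the new weights, from the error in the
  -- weights. Convexity of the square bounds the first part (`s1`).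
  have e : (1 - ρ') * v0 + ρ' * (v1 + δ) - ((1 - ρ) * u0 + ρ * (u1 + δ))
      = ((1 - ρ') * (v0 - u0) + ρ' * (v1 - u1)) + (ρ' - ρ) * (u1 + δ - u0) := by ring
  have s1 : ((1 - ρ') * (v0 - u0) + ρ' * (v1 - u1)) ^ 2 ≤ (v0 - u0) ^ 2 + (v1 - u1) ^ 2 := by
    have hp := mul_nonneg (sub_nonneg.2 hρ.2) hρ.1
    linarith [mul_nonneg hp (sq_nonneg ((v0 - u0) - (v1 - u1))),
      mul_nonneg hρ.1 (sq_nonneg (v0 - u0)),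
      mul_nonneg (sub_nonneg.2 hρ.2) (sq_nonneg (v1 - u1))]
  have s2 : (u1 + δ - u0) ^ 2 ≤ (2 * C + δ) ^ 2 := sq_le_sq' (by linarith) (by linarith)
  rw [e]
  refine add_sq_le.trans ?_
  rw [mul_pow]
  linarith [mul_le_mul_of_nonneg_left s2 (sq_nonneg (ρ' - ρ))]

/-- Weighted revenue lost by tied prices `(t, t - δ)`. -/
theorem weighted_sq_tied {w v ρ u0 u1 δ t : ℝ} (hρ : ρ * w = (1 - ρ) * v) :
    w * (t - u0) ^ 2 + v * (t - δ - u1) ^ 2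
      = (w + v) * (t - ((1 - ρ) * u0 + ρ * (u1 + δ))) ^ 2
        + ρ * w * (δ - (u0 - u1)) ^ 2 := by
  linear_combination
    (2 * (t - ((1 - ρ) * u0 + ρ * (u1 + δ))) * (δ - (u0 - u1))
      - (1 - ρ) * (δ - (u0 - u1)) ^ 2) * hρ

/-- Loss of the plug-in prices: quadratic in the estimation error, up to the effect of the safety
margin for features whose price gap lies just below the fairness level. -/
theorem weightedRevenue_fairPrice_sub_le {d : ℕ} {q δ m amin amax bmax xmax : ℝ}
    (hq : q ∈ Set.Ioo (0 : ℝ) 1) (hδ : 0 ≤ δ) (hamin : 0 < amin) (hamax : 0 < amax)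
    {θ θ' : Fin 2 → Param d}
    (h : ∀ j, θ j ∈ paramSet d amin amax bmax) (h' : ∀ j, θ' j ∈ paramSet d amin amax bmax)
    {x : Feature d} (hx : ‖x‖ ≤ xmax) :
    weightedRevenue q θ (fun j => fairPrice q δ 0 θ j x) x
        - weightedRevenue q θ (fun j => fairPrice q δ m θ' j x) x
      ≤ amax * (10 * ((bmax * (1 + xmax)) ^ 2 / (2 * amin ^ 4) + (1 + xmax ^ 2) / (2 * amin ^ 2))
          + 4 * (bmax * (1 + xmax) / amin + δ) ^ 2 * (amax ^ 2 / amin ^ 4))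
        * (paramDist (θ' 0) (θ 0) + paramDist (θ' 1) (θ 1))
        + 4 * amax * m ^ 2
          * Set.indicator {y | 0 < δ - gap θ y ∧ δ - gap θ y ≤ 2 * m} (fun _ => (1 : ℝ)) x := by
  have hn : ∀ j, (θ j).1 < 0 := fun j => (slope_mem (h j)).1
  have hn' : ∀ j, (θ' j).1 < 0 := fun j => (slope_mem (h' j)).1
  have hw := mul_neg_of_pos_of_neg hq.1 (hn 0)
  have hv := mul_neg_of_pos_of_neg (sub_pos.2 hq.2) (hn 1)
  have hwv := (weighted_slope_mem hq h).2
  have hρ := slopeShare_mem hq hn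
  have hbal : slopeShare q θ * -(q * (θ 0).1) = (1 - slopeShare q θ) * -((1 - q) * (θ 1).1) := by
    have := (weighted_slope_neg hq hn).ne
    rw [slopeShare]; field_simp; ring
  have e0 := monopolyPrice_sub_sq_le hamin (h' 0) (h 0) hx
  have e1 := monopolyPrice_sub_sq_le hamin (h' 1) (h 1) hx
  have et := tiedPrice_sub_sq_le hq hδ hamin h h' hx
  have es := slopeShare_sub_sq_le hq hamin h' h
  have hN0 := paramDist_nonneg (θ' 0) (θ 0)
  have hN1 := paramDist_nonneg (θ' 1) (θ 1)
  have hind : 0 ≤ Set.indicator {y | 0 < δ - gap θ y ∧ δ - gap θ y ≤ 2 * m}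
      (fun _ => (1 : ℝ)) x := Set.indicator_nonneg (fun _ _ => zero_le_one) _
  have hind1 : 0 < δ - gap θ x → δ - gap θ x ≤ 2 * m →
      Set.indicator {y | 0 < δ - gap θ y ∧ δ - gap θ y ≤ 2 * m} (fun _ => (1 : ℝ)) x = 1 :=
    fun h1 h2 => Set.indicator_of_mem (s := {y | 0 < δ - gap θ y ∧ δ - gap θ y ≤ 2 * m}) ⟨h1, h2⟩ _
  have hC : 0 ≤ (bmax * (1 + xmax) / amin + δ) ^ 2 := sq_nonneg _
  have hK : 0 ≤ (bmax * (1 + xmax)) ^ 2 / (2 * amin ^ 4) + (1 + xmax ^ 2) / (2 * amin ^ 2) := by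
    positivity
  have hA : 0 ≤ amax ^ 2 / amin ^ 4 := by positivity
  rw [mul_div_assoc] at es
  have et' : (tiedPrice q δ θ' x - tiedPrice q δ θ x) ^ 2
      ≤ (2 * ((bmax * (1 + xmax)) ^ 2 / (2 * amin ^ 4) + (1 + xmax ^ 2) / (2 * amin ^ 2))
          + 4 * (bmax * (1 + xmax) / amin + δ) ^ 2 * (amax ^ 2 / amin ^ 4))
        * (paramDist (θ' 0) (θ 0) + paramDist (θ' 1) (θ 1)) := by
    have := mul_le_mul_of_nonneg_left es hC
    linarith
  rw [weightedRevenue_sub q hn]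
  generalize Set.indicator {y | 0 < δ - gap θ y ∧ δ - gap θ y ≤ 2 * m} (fun _ => (1 : ℝ)) x = I
    at *
  generalize (bmax * (1 + xmax) / amin + δ) ^ 2 = C at *
  generalize (bmax * (1 + xmax)) ^ 2 / (2 * amin ^ 4) + (1 + xmax ^ 2) / (2 * amin ^ 2) = K at *
  generalize amax ^ 2 / amin ^ 4 = A at *
  generalize paramDist (θ' 0) (θ 0) = N0 at *
  generalize paramDist (θ' 1) (θ 1) = N1 at *
  have hCA : 0 ≤ C * A := mul_nonneg hC hA
  have hmI : 0 ≤ 4 * amax * m ^ 2 * I := by positivity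
  have hCAN : 0 ≤ C * A * (N0 + N1) := by positivity
  have hKN : 0 ≤ K * (N0 + N1) := by positivity
  by_cases g' : gap θ' x ≤ δ - m
  -- Untied plug-in prices: the clairvoyant's own squared distances only help and are dropped, so
  -- whether the constraint truly binds is irrelevant here.
  · have hub : q * (θ 0).1 * ((fairPrice q δ 0 θ 0 x - monopolyPrice (θ 0) x) ^ 2
          - (fairPrice q δ m θ' 0 x - monopolyPrice (θ 0) x) ^ 2)
        + (1 - q) * (θ 1).1 * ((fairPrice q δ 0 θ 1 x - monopolyPrice (θ 1) x) ^ 2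
          - (fairPrice q δ m θ' 1 x - monopolyPrice (θ 1) x) ^ 2)
        ≤ amax * ((monopolyPrice (θ' 0) x - monopolyPrice (θ 0) x) ^ 2
          + (monopolyPrice (θ' 1) x - monopolyPrice (θ 1) x) ^ 2) := by
      rw [fairPrice_of_gap_le g', fairPrice_of_gap_le g']
      linarith only [mul_nonneg (neg_pos.2 hw).le
          (sq_nonneg (fairPrice q δ 0 θ 0 x - monopolyPrice (θ 0) x)),
        mul_nonneg (neg_pos.2 hv).le
          (sq_nonneg (fairPrice q δ 0 θ 1 x - monopolyPrice (θ 1) x)),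
        mul_nonneg (show 0 ≤ amax + q * (θ 0).1 by linarith)
          (sq_nonneg (monopolyPrice (θ' 0) x - monopolyPrice (θ 0) x)),
        mul_nonneg (show 0 ≤ amax + (1 - q) * (θ 1).1 by linarith)
          (sq_nonneg (monopolyPrice (θ' 1) x - monopolyPrice (θ 1) x))]
    refine hub.trans ?_
    have hs : (monopolyPrice (θ' 0) x - monopolyPrice (θ 0) x) ^ 2
        + (monopolyPrice (θ' 1) x - monopolyPrice (θ 1) x) ^ 2
        ≤ (10 * K + 4 * C * A) * (N0 + N1) := by
      linarith only [e0, e1, hKN, hCAN, mul_nonneg hK hN0, mul_nonneg hK hN1]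
    linarith only [mul_le_mul_of_nonneg_left hs hamax.le, hmI]
  · have loss := weighted_sq_tied (u0 := monopolyPrice (θ 0) x) (u1 := monopolyPrice (θ 1) x)
      (δ := δ) (t := tiedPrice q δ θ' x) hbal
    have opt := weighted_sq_tied (u0 := monopolyPrice (θ 0) x) (u1 := monopolyPrice (θ 1) x)
      (δ := δ) (t := tiedPrice q δ θ x) hbal
    rw [← tiedPrice, ← gap_eq] at loss opt
    have hT : (-(q * (θ 0).1) + -((1 - q) * (θ 1).1))
        * (tiedPrice q δ θ' x - tiedPrice q δ θ x) ^ 2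
        ≤ amax * ((2 * K + 4 * C * A) * (N0 + N1)) :=
      mul_le_mul (by linarith) et' (sq_nonneg _) hamax.le
    rw [fairPrice_one_of_lt_gap g', fairPrice_zero_of_lt_gap hq hn' g']
    by_cases g : gap θ x ≤ δ - 0
    · rw [fairPrice_of_gap_le g, fairPrice_of_gap_le g]
      have hρw : slopeShare q θ * -(q * (θ 0).1) * (δ - gap θ x) ^ 2
          ≤ amax * (δ - gap θ x) ^ 2 := by
        refine mul_le_mul_of_nonneg_right ?_ (sq_nonneg _)
        have := mul_nonneg (sub_nonneg.2 hρ.2) (neg_pos.2 hw).le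
        linarith only [this, hwv, hv]
      -- Prices tied although the true gap permits monopoly prices. Either `x` lies in the strip of
      -- width `2 * m`, or the estimated gap exceeds the true one by more than half of `δ - gap θ
      -- x`; squaring the latter gives the factor `8`, which with the `2` from `hT` makes the `10`
      -- of the statement.
      have hG : (δ - gap θ x) ^ 2 ≤ 8 * K * (N0 + N1) + 4 * m ^ 2 * I := by
        have hmI' : 0 ≤ m ^ 2 * I := by positivity
        rcases (sub_nonneg.2 g).eq_or_lt with h0 | h0
        · rw [sub_zero] at h0; rw [← h0]; linarith only [hKN, hmI']
        rw [sub_zero] at h0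
        by_cases h2 : δ - gap θ x ≤ 2 * m
        · rw [hind1 h0 h2]
          linarith only [hKN, pow_le_pow_left₀ h0.le h2 2]
        · have hgg := gap_eq θ x
          have hgg' := gap_eq θ' x
          rw [not_le] at g' h2
          have hdiff : δ - gap θ x ≤ 2 * ((monopolyPrice (θ' 0) x - monopolyPrice (θ 0) x)
              - (monopolyPrice (θ' 1) x - monopolyPrice (θ 1) x)) := by
            linarith only [hgg, hgg', g', h2]
          have hsq := pow_le_pow_left₀ h0.le hdiff 2
          linarith only [hsq, hmI', e0, e1, sq_nonneg ((monopolyPrice (θ' 0) x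
            - monopolyPrice (θ 0) x) + (monopolyPrice (θ' 1) x - monopolyPrice (θ 1) x))]
      linarith only [mul_le_mul_of_nonneg_left hG hamax.le, hρw, hT, loss]
    -- Both price pairs are tied: the cost of tying in `loss` and `opt` cancels.
    · rw [fairPrice_one_of_lt_gap g, fairPrice_zero_of_lt_gap hq hn g]
      rw [sub_self] at opt
      linarith only [mul_nonneg hamax.le hKN, hmI, hT, loss, opt]

/-! ### Two general estimates -/

/-- If `c |v|²` is bounded by a linear plus a quadratic form, with `|v|² ≤ R`, then `|v|²` is
bounded by the squared sizes of the two forms. -/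
theorem sq_mul_sum_sq_le {κ : Type*} [Fintype κ] {c R : ℝ} (hc : 0 ≤ c) {v W : κ → ℝ}
    {E : κ → κ → ℝ} (hR : ∑ k, v k ^ 2 ≤ R)
    (h : c * ∑ k, v k ^ 2 ≤ 2 * ∑ k, v k * W k + ∑ k, ∑ l, E k l * (v k * v l)) :
    c ^ 2 * ∑ k, v k ^ 2 ≤ 8 * ∑ k, W k ^ 2 + 2 * R * ∑ k, ∑ l, E k l ^ 2 := by
  have hlin := Finset.sum_mul_sq_le_sq_mul_sq Finset.univ v W
  have hquad := Finset.sum_mul_sq_le_sq_mul_sq Finset.univ (fun a : κ × κ => E a.1 a.2)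
    (fun a => v a.1 * v a.2)
  simp only [← Finset.univ_product_univ, Finset.sum_product] at hquad
  have hS : ∑ k, ∑ l, (v k * v l) ^ 2 = (∑ k, v k ^ 2) * ∑ k, v k ^ 2 := by
    simp_rw [mul_pow, Finset.sum_mul_sum]
  rw [hS] at hquad
  have hS0 : 0 ≤ ∑ k, v k ^ 2 := Finset.sum_nonneg fun _ _ => sq_nonneg _
  have hW0 : 0 ≤ ∑ k, W k ^ 2 := Finset.sum_nonneg fun _ _ => sq_nonneg _
  have hE0 : 0 ≤ ∑ k, ∑ l, E k l ^ 2 :=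
    Finset.sum_nonneg fun _ _ => Finset.sum_nonneg fun _ _ => sq_nonneg _
  generalize ∑ k, v k ^ 2 = S at *
  generalize ∑ k, W k ^ 2 = W2 at *
  generalize ∑ k, ∑ l, E k l ^ 2 = F at *
  generalize ∑ k, v k * W k = a at *
  generalize ∑ k, ∑ l, E k l * (v k * v l) = b at *
  have hFS : F * S ≤ F * R := mul_le_mul_of_nonneg_left hR hE0
  rcases hS0.eq_or_lt with h0 | h0
  · rw [← h0] at hFS ⊢; linarith
  · refine le_of_mul_le_mul_right ?_ h0
    have h1 : (c * S) ^ 2 ≤ (2 * a + b) ^ 2 := pow_le_pow_left₀ (by positivity) h 2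
    have h2 : (2 * a + b) ^ 2 ≤ 2 * ((2 * a) ^ 2 + b ^ 2) := add_sq_le
    linarith [mul_le_mul_of_nonneg_right hFS h0.le]

/-- The squared deviation of a sum of independent variables from its mean. -/
theorem integral_sum_sub_sq_le {Ω : Type*} [MeasurableSpace Ω] {μ : Measure Ω}
    [IsProbabilityMeasure μ] {f : ℕ → Ω → ℝ} (hf : ∀ i, MemLp (f i) 2 μ)
    (hind : Pairwise fun i j => IndepFun (f i) (f j) μ) (n : ℕ) :
    ∫ ω, (∑ i ∈ Finset.range n, f i ω - ∑ i ∈ Finset.range n, ∫ ω', f i ω' ∂μ) ^ 2 ∂μ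
      ≤ ∑ i ∈ Finset.range n, ∫ ω, f i ω ^ 2 ∂μ := by
  have hS : MemLp (∑ i ∈ Finset.range n, f i) 2 μ := memLp_finsetSum' _ fun i _ => hf i
  have hmean : ∫ ω, (∑ i ∈ Finset.range n, f i) ω ∂μ = ∑ i ∈ Finset.range n, ∫ ω', f i ω' ∂μ := by
    simp only [Finset.sum_apply]
    exact integral_finsetSum _ fun i _ => (hf i).integrable one_le_two
  have hv := variance_eq_integral hS.1.aemeasurable
  rw [hmean, IndepFun.variance_sum (fun i _ => hf i) fun i _ j _ hij => hind hij] at hv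
  simp only [Finset.sum_apply] at hv
  rw [← hv]
  exact Finset.sum_le_sum fun i _ => variance_le_expectation_sq (hf i).1

/-- Second moment of a sub-Gaussian variable. -/
theorem integral_sq_le_of_hasSubgaussianMGF {Ω : Type*} [MeasurableSpace Ω] {μ : Measure Ω}
    {X : Ω → ℝ} {c : ℝ≥0} (h : HasSubgaussianMGF X c μ) :
    ∫ ω, X ω ^ 2 ∂μ ≤ 4 * Real.exp (c / 2) := by
  have h1 := h.mgf_le 1
  have h2 := h.mgf_le (-1)
  have i1 := h.integrable_exp_mul 1
  have i2 := h.integrable_exp_mul (-1)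
  simp only [mgf, one_mul, neg_mul, one_pow, mul_one, even_two.neg_pow] at h1 h2 i1 i2
  have hX : Integrable (fun ω => X ω ^ 2) μ := (h.memLp 2).integrable_sq
  calc ∫ ω, X ω ^ 2 ∂μ ≤ ∫ ω, 2 * (Real.exp (X ω) + Real.exp (-X ω)) ∂μ := by
        -- Pointwise `x² / 2 ≤ exp |x| ≤ exp x + exp (-x)`, so the bounds on the moment generating
        -- function at `1` and `-1` suffice.
        refine integral_mono hX ((i1.add i2).const_mul 2) fun ω => ?_
        have hq := Real.quadratic_le_exp_of_nonneg (abs_nonneg (X ω))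
        have ha : Real.exp |X ω| ≤ Real.exp (X ω) + Real.exp (-X ω) := by
          rcases abs_cases (X ω) with h | h <;> rw [h.1] <;>
            linarith [Real.exp_pos (X ω), Real.exp_pos (-X ω)]
        have := abs_nonneg (X ω)
        simp only [sq_abs] at hq ⊢
        linarith
    _ = 2 * (∫ ω, Real.exp (X ω) ∂μ + ∫ ω, Real.exp (-X ω) ∂μ) := by
        rw [integral_const_mul, integral_add i1 i2]
    _ ≤ _ := by linarith

/-- A variable with conditional mean zero is uncorrelated with the conditioning variables. -/
theorem integral_mul_eq_zero_of_condExp {Ω : Type*} {m mΩ : MeasurableSpace Ω} {μ : Measure Ω}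
    [IsFiniteMeasure μ] (hm : m ≤ mΩ) {f g : Ω → ℝ} (hg : StronglyMeasurable[m] g)
    (hfg : Integrable (fun ω => f ω * g ω) μ) (hf : Integrable f μ) (h : μ[f | m] =ᵐ[μ] 0) :
    ∫ ω, f ω * g ω ∂μ = 0 := by
  refine (integral_condExp hm).symm.trans
    ((integral_congr_ae (g := fun _ => (0 : ℝ)) ?_).trans (integral_zero _ _))
  filter_upwards [condExp_mul_of_stronglyMeasurable_right hg hfg hf, h] with ω h1 h2
  refine h1.trans ?_
  simp [h2]

/-! ### Moments of one exploration round -/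

/-- The regression vector `(p, 1, x)`. -/
def regressor {d : ℕ} (p : ℝ) (x : Feature d) : Fin (d + 2) → ℝ := Fin.cons p (augment x)

/-- A parameter `(α, β)` as one coefficient vector. -/
def coeffs {d : ℕ} (θ : Param d) : Fin (d + 2) → ℝ := Fin.cons θ.1 θ.2

theorem sum_coeffs_mul_regressor {d : ℕ} (θ : Param d) (p : ℝ) (x : Feature d) :
    ∑ k, coeffs θ k * regressor p x k = θ.1 * p + lin θ.2 x := by
  rw [lin_eq_sum]; simp [coeffs, regressor, Fin.sum_univ_succ]

theorem sum_coeffs_sub_sq {d : ℕ} (θ θ' : Param d) :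
    ∑ k, (coeffs θ k - coeffs θ' k) ^ 2 = paramDist θ θ' := by
  simp [coeffs, paramDist, Fin.sum_univ_succ]

theorem sum_regressor_sq {d : ℕ} (p : ℝ) (x : Feature d) :
    ∑ k, regressor p x k ^ 2 = p ^ 2 + (1 + ‖x‖ ^ 2) := by
  rw [← sum_augment_sq]; simp [regressor, Fin.sum_univ_succ]

theorem measurable_augment {d : ℕ} (k : Fin (d + 1)) :
    Measurable fun x : Feature d => augment x k := by
  refine Fin.cases ?_ (fun k => ?_) k
  · simp [augment]
  · simp only [augment, Fin.cons_succ]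
    fun_prop

theorem measurable_regressor {d : ℕ} {A : Type*} {_ : MeasurableSpace A} {p : A → ℝ}
    {x : A → Feature d} (hp : Measurable p) (hx : Measurable x) (k : Fin (d + 2)) :
    Measurable fun a => regressor (p a) (x a) k := by
  refine Fin.cases ?_ (fun k => ?_) k
  · simpa [regressor] using hp
  · simp only [regressor, Fin.cons_succ]
    exact (measurable_augment k).comp hx

/-- The diameter of the parameter set is free of `d`, since the Euclidean norm is at most the `ℓ¹`
norm; the two slopes have the same sign, whence `amax` and not `2 * amax`. -/
theorem paramDist_le {d : ℕ} {amin amax bmax : ℝ} {θ θ' : Param d}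
    (h : θ ∈ paramSet d amin amax bmax) (h' : θ' ∈ paramSet d amin amax bmax) :
    paramDist θ θ' ≤ amax ^ 2 + (2 * bmax) ^ 2 := by
  obtain ⟨n0, -, x0⟩ := slope_mem h
  obtain ⟨n1, -, x1⟩ := slope_mem h'
  refine add_le_add (sq_le_sq' (by linarith) (by linarith)) ?_
  calc ∑ k, (θ.2 k - θ'.2 k) ^ 2 = ∑ k, |θ.2 k - θ'.2 k| ^ 2 := by simp only [sq_abs]
    _ ≤ (∑ k, |θ.2 k - θ'.2 k|) ^ 2 := Finset.sum_sq_le_sq_sum_of_nonneg fun _ _ => abs_nonneg _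
    _ ≤ (2 * bmax) ^ 2 := by
        refine pow_le_pow_left₀ (Finset.sum_nonneg fun _ _ => abs_nonneg _) ?_ 2
        calc ∑ k, |θ.2 k - θ'.2 k| ≤ ∑ k, (|θ.2 k| + |θ'.2 k|) :=
              Finset.sum_le_sum fun k _ => abs_sub _ _
          _ ≤ 2 * bmax := by
              rw [Finset.sum_add_distrib]; linarith [h.2.2.2, h'.2.2.2]

section Moments

variable {d : ℕ} {Ω : Type u} [MeasurableSpace Ω] {μ : Measure Ω}
  {M : Market d Ω} {B xmax amin amax bmax lam : ℝ} {σ : ℝ≥0}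

theorem Market.Model.price_mem (hM : M.Model μ B σ) (i : ℕ) :
    ∀ᵐ ω ∂μ, M.U i ω ∈ Set.Ioo 0 B := by
  have h : ∀ᵐ p ∂(μ.map (M.U i)), p ∈ Set.Ioo 0 B := by
    rw [show μ.map (M.U i) = _ from hM.uniform_U i]
    exact ae_cond_mem measurableSet_Ioo
  exact ae_of_ae_map (hM.measurable_U i).aemeasurable h

theorem Market.Model.integral_price (hM : M.Model μ B σ) (hB : 0 < B) (i : ℕ) {f : ℝ → ℝ}
    (hf : Measurable f) : ∫ ω, f (M.U i ω) ∂μ = B⁻¹ * ∫ p in (0 : ℝ)..B, f p := by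
  rw [← integral_map (f := f) (hM.measurable_U i).aemeasurable hf.aestronglyMeasurable,
    show μ.map (M.U i) = _ from hM.uniform_U i, ProbabilityTheory.cond, integral_smul_measure,
    intervalIntegral.integral_of_le hB.le, integral_Ioc_eq_integral_Ioo]
  simp [hB.le]

theorem Market.Model.price_moments (hM : M.Model μ B σ) (hB : 0 < B) (i : ℕ) (a b : ℝ) :
    ∫ ω, (a * M.U i ω + b) ^ 2 ∂μ = a ^ 2 * B ^ 2 / 3 + a * b * B + b ^ 2 := by
  rw [hM.integral_price hB i (f := fun p => (a * p + b) ^ 2) (by fun_prop)]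
  have h : ∀ p : ℝ, (a * p + b) ^ 2 = a ^ 2 * p ^ 2 + 2 * a * b * p + b ^ 2 := fun p => by ring
  simp only [h]
  rw [intervalIntegral.integral_add (Continuous.intervalIntegrable (by fun_prop) _ _)
      (Continuous.intervalIntegrable (by fun_prop) _ _),
    intervalIntegral.integral_add (Continuous.intervalIntegrable (by fun_prop) _ _)
      (Continuous.intervalIntegrable (by fun_prop) _ _),
    intervalIntegral.integral_const_mul, intervalIntegral.integral_const_mul, integral_pow,
    integral_id, intervalIntegral.integral_const]
  have := hB.ne'
  simp only [smul_eq_mul]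
  field_simp
  ring

theorem Market.Model.integral_feature_mul (hM : M.Model μ B σ) (i : ℕ) (k l : Fin d) :
    ∫ ω, M.X i ω k * M.X i ω l ∂μ = M.secondMoment μ k l := by
  have hp : Measurable fun x : Feature d => x k * x l := by fun_prop
  exact ((hM.ident_X i).comp hp).integral_eq

variable [IsProbabilityMeasure μ]

theorem Market.Bounded.memLp_feature (hM : M.Model μ B σ) (hb : M.Bounded μ xmax amin amax bmax)
    (i : ℕ) (k : Fin d) : MemLp (fun ω => M.X i ω k) 2 μ := by
  have hm := hM.measurable_X i
  refine MemLp.of_bound (by fun_prop) xmax ?_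
  filter_upwards [hb.features i] with ω hω using (PiLp.norm_apply_le _ k).trans hω

theorem Market.Model.integral_feature (hM : M.Model μ B σ)
    (hb : M.Bounded μ xmax amin amax bmax) (i : ℕ) (k : Fin d) : ∫ ω, M.X i ω k ∂μ = 0 := by
  have hX : Integrable (M.X 0) μ :=
    Integrable.of_bound (hM.measurable_X 0).aestronglyMeasurable xmax (hb.features 0)
  have hp : Measurable fun x : Feature d => x k := by fun_prop
  refine ((hM.ident_X i).comp hp).integral_eq.trans ?_
  have := (EuclideanSpace.proj (𝕜 := ℝ) k).integral_comp_comm hX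
  simpa [hM.mean_X] using this

theorem Market.EigenBound.le_integral (hM : M.Model μ B σ)
    (hb : M.Bounded μ xmax amin amax bmax) (he : M.EigenBound μ lam) (i : ℕ) (w : Fin d → ℝ) :
    lam * ∑ k, w k ^ 2 ≤ ∫ ω, (∑ k, w k * M.X i ω k) ^ 2 ∂μ := by
  have hint : ∀ k l, Integrable (fun ω => w k * M.X i ω k * (w l * M.X i ω l)) μ := fun k l =>
    ((hb.memLp_feature hM i k).const_mul (w k)).integrable_mul
      ((hb.memLp_feature hM i l).const_mul (w l))
  have h : ∫ ω, (∑ k, w k * M.X i ω k) ^ 2 ∂μ = w ⬝ᵥ (M.secondMoment μ).mulVec w := by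
    simp only [sq, Finset.sum_mul_sum]
    rw [integral_finsetSum _ fun k _ => integrable_finsetSum _ fun l _ => hint k l]
    simp only [dotProduct, Matrix.mulVec, Finset.mul_sum]
    refine Finset.sum_congr rfl fun k _ => ?_
    rw [integral_finsetSum _ fun l _ => hint k l]
    refine Finset.sum_congr rfl fun l _ => ?_
    rw [← hM.integral_feature_mul i k l, mul_comm (∫ _, _ ∂_), ← mul_assoc, ← integral_const_mul]
    exact integral_congr_ae (.of_forall fun ω => by ring)
  have := he w
  rw [h]
  simpa [dotProduct, sq] using this

/-- The population second moment of the regression vector is well conditioned. -/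
theorem Market.EigenBound.regressor_lower (hM : M.Model μ B σ) (hB : 0 < B)
    (hb : M.Bounded μ xmax amin amax bmax) (he : M.EigenBound μ lam) (i : ℕ)
    (v : Fin (d + 2) → ℝ) :
    min (B ^ 2 / (12 + 4 * B ^ 2)) lam * ∑ k, v k ^ 2
      ≤ ∫ ω, (∑ k, v k * regressor (M.U i ω) (M.X i ω) k) ^ 2 ∂μ := by
  set a := v 0
  set b := v 1
  set w : Fin d → ℝ := fun k => v k.succ.succ
  have hsum : ∑ k, v k ^ 2 = (a ^ 2 + b ^ 2) + ∑ k, w k ^ 2 := by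
    simp [Fin.sum_univ_succ, a, b, w, add_assoc]
  have hX := hM.measurable_X i
  have hU := hM.measurable_U i
  have hreg : ∀ ω, (∑ k, v k * regressor (M.U i ω) (M.X i ω) k) ^ 2
      = (a * M.U i ω + b) ^ 2 + 2 * ((∑ k, w k * M.X i ω k) * (a * M.U i ω + b))
        + (∑ k, w k * M.X i ω k) ^ 2 := fun ω => by
    simp [Fin.sum_univ_succ, regressor, augment, a, b, w]
    ring
  have hY : MemLp (fun ω => a * M.U i ω + b) 2 μ := by
    refine MemLp.of_bound (by fun_prop) (|a| * B + |b|) ?_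
    filter_upwards [hM.price_mem i] with ω hω
    rw [Real.norm_eq_abs]
    refine (abs_add_le _ _).trans ?_
    rw [abs_mul, abs_of_pos hω.1]
    gcongr
    exact hω.2.le
  have hV : MemLp (fun ω => ∑ k, w k * M.X i ω k) 2 μ :=
    memLp_finsetSum _ fun k _ => (hb.memLp_feature hM i k).const_mul (w k)
  -- Independence of price and features factors the integral, and the centred features make it
  -- vanish; price and features thus separate into two blocks.
  have hcross : ∫ ω, (∑ k, w k * M.X i ω k) * (a * M.U i ω + b) ∂μ = 0 := by
    rw [IndepFun.integral_fun_comp_mul_comp (f := fun x : Feature d => ∑ k, w k * x k)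
      (g := fun p => a * p + b) (hM.indep_price i) hX.aemeasurable hU.aemeasurable
      (by fun_prop) (by fun_prop),
      integral_finsetSum _ fun k _ =>
        ((hb.memLp_feature hM i k).integrable one_le_two).const_mul (w k)]
    simp [integral_const_mul, hM.integral_feature hb]
  -- The second-moment matrix of `(p, 1)` has determinant `B² / 12` and trace `1 + B² / 3`; its
  -- least eigenvalue is at least their quotient, which is the constant here.
  have hprice : B ^ 2 / (12 + 4 * B ^ 2) * (a ^ 2 + b ^ 2) ≤ ∫ ω, (a * M.U i ω + b) ^ 2 ∂μ := by
    rw [hM.price_moments hB, div_mul_eq_mul_div, div_le_iff₀ (by positivity)]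
    nlinarith [sq_nonneg (3 * a * B + 6 * b), sq_nonneg (a * B * B), sq_nonneg (2 * a * B + 3 * b), sq_nonneg (B * (2 * a * B + 3 * b)), sq_nonneg (B * b)]
  simp only [hreg]
  have hVY : Integrable (fun ω => 2 * ((∑ k, w k * M.X i ω k) * (a * M.U i ω + b))) μ :=
    (hV.integrable_mul hY).const_mul 2
  have hYVY : Integrable (fun ω => (a * M.U i ω + b) ^ 2
      + 2 * ((∑ k, w k * M.X i ω k) * (a * M.U i ω + b))) μ := hY.integrable_sq.add hVY
  rw [integral_add hYVY hV.integrable_sq, integral_add hY.integrable_sq hVY,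
    integral_const_mul, hcross,
    hsum, mul_add]
  have h1 : min (B ^ 2 / (12 + 4 * B ^ 2)) lam * (a ^ 2 + b ^ 2)
      ≤ B ^ 2 / (12 + 4 * B ^ 2) * (a ^ 2 + b ^ 2) :=
    mul_le_mul_of_nonneg_right (min_le_left _ _) (by positivity)
  have h2 : min (B ^ 2 / (12 + 4 * B ^ 2)) lam * ∑ k, w k ^ 2 ≤ lam * ∑ k, w k ^ 2 :=
    mul_le_mul_of_nonneg_right (min_le_right _ _) (Finset.sum_nonneg fun _ _ => sq_nonneg _)
  linarith [he.le_integral hM hb i w]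

end Moments

/-! ### Mean squared error of the constrained least squares estimator -/

section Estimation

variable {d : ℕ} {Ω : Type u}

/-- The probability of a group. -/
def Market.groupProb (M : Market d Ω) (j : Fin 2) : ℝ := if j = 0 then M.q else 1 - M.q

/-- The indicator that the buyer of round `i` belongs to group `j`. -/
def Market.inGroup (M : Market d Ω) (j : Fin 2) (i : ℕ) (ω : Ω) : ℝ := if M.G i ω = j then 1 else 0

/-- The regression vector of round `i`. -/
def Market.regr (M : Market d Ω) (i : ℕ) (ω : Ω) : Fin (d + 2) → ℝ :=
  regressor (M.U i ω) (M.X i ω)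

/-- The contribution of round `i` to the Gram matrix of group `j`. -/
def Market.gramTerm (M : Market d Ω) (j : Fin 2) (k l : Fin (d + 2)) (i : ℕ) (ω : Ω) : ℝ :=
  M.inGroup j i ω * (M.regr i ω k * M.regr i ω l)

/-- The contribution of round `i` to the score of group `j`. -/
def Market.scoreTerm (M : Market d Ω) (j : Fin 2) (k : Fin (d + 2)) (i : ℕ) (ω : Ω) : ℝ :=
  M.inGroup j i ω * (M.noise i ω * M.regr i ω k)

theorem Market.inGroup_sq (M : Market d Ω) (j : Fin 2) (i : ℕ) (ω : Ω) :
    M.inGroup j i ω ^ 2 = M.inGroup j i ω := by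
  unfold Market.inGroup; split_ifs <;> simp

theorem Market.inGroup_nonneg (M : Market d Ω) (j : Fin 2) (i : ℕ) (ω : Ω) :
    0 ≤ M.inGroup j i ω := by
  unfold Market.inGroup; split_ifs <;> simp

theorem Market.abs_inGroup_le (M : Market d Ω) (j : Fin 2) (i : ℕ) (ω : Ω) :
    |M.inGroup j i ω| ≤ 1 := by
  unfold Market.inGroup; split_ifs <;> simp

/-- In rounds of group `j` the demand follows `M.θ j`, so the residual is the noise minus the
parameter error applied to the regression vector. -/
theorem Market.sqLoss_exploreData (M : Market d Ω) (n : ℕ) (j : Fin 2) (θ : Param d) (ω : Ω) :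
    sqLoss (M.exploreData n ω) j θ = ∑ i ∈ Finset.range n, M.inGroup j i ω
      * (M.noise i ω - ∑ k, (coeffs θ k - coeffs (M.θ j) k) * M.regr i ω k) ^ 2 := by
  rw [sqLoss, Finset.sum_range]
  refine Finset.sum_congr rfl fun i _ => ?_
  by_cases h : M.G i ω = j
  · have h' : (M.exploreData n ω i).2.1 = j := h
    rw [if_pos h', Market.inGroup, if_pos h, one_mul, Market.regr]
    simp only [Market.exploreData, h, sub_mul, Finset.sum_sub_distrib, sum_coeffs_mul_regressor]
    ring
  · have h' : ¬(M.exploreData n ω i).2.1 = j := h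
    rw [if_neg h', Market.inGroup, if_neg h, zero_mul]

/-- The basic inequality of least squares. -/
theorem Market.basic_inequality (M : Market d Ω) {n : ℕ} {j : Fin 2} {θ : Param d} {ω : Ω}
    (h : sqLoss (M.exploreData n ω) j θ ≤ sqLoss (M.exploreData n ω) j (M.θ j)) :
    ∑ k, ∑ l, (∑ i ∈ Finset.range n, M.gramTerm j k l i ω)
        * ((coeffs θ k - coeffs (M.θ j) k) * (coeffs θ l - coeffs (M.θ j) l))
      ≤ 2 * ∑ k, (coeffs θ k - coeffs (M.θ j) k)
          * ∑ i ∈ Finset.range n, M.scoreTerm j k i ω := by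
  rw [M.sqLoss_exploreData, M.sqLoss_exploreData] at h
  simp only [sub_self, zero_mul, Finset.sum_const_zero, sub_zero] at h
  generalize coeffs (M.θ j) = b at *
  generalize coeffs θ = a at *
  have hg : ∑ k, ∑ l, (∑ i ∈ Finset.range n, M.gramTerm j k l i ω) * ((a k - b k) * (a l - b l))
      = ∑ i ∈ Finset.range n, M.inGroup j i ω * (∑ k, (a k - b k) * M.regr i ω k) ^ 2 := by
    simp only [Finset.sum_mul, sq, Finset.mul_sum, Market.gramTerm]
    rw [Finset.sum_congr rfl fun k _ => Finset.sum_comm, Finset.sum_comm]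
    refine Finset.sum_congr rfl fun i _ => Finset.sum_congr rfl fun k _ =>
      Finset.sum_congr rfl fun l _ => ?_
    ring
  have hs : ∑ k, (a k - b k) * ∑ i ∈ Finset.range n, M.scoreTerm j k i ω
      = ∑ i ∈ Finset.range n, M.inGroup j i ω
        * (M.noise i ω * ∑ k, (a k - b k) * M.regr i ω k) := by
    simp only [Finset.mul_sum, Market.scoreTerm]
    rw [Finset.sum_comm]
    refine Finset.sum_congr rfl fun i _ => Finset.sum_congr rfl fun k _ => ?_
    ring
  -- Expanding the square, the squared noise cancels; what is left is twice the score term minus the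
  -- Gram term.
  rw [hg, hs, Finset.mul_sum, ← sub_nonneg, ← Finset.sum_sub_distrib]
  rw [← sub_nonneg, ← Finset.sum_sub_distrib] at h
  refine h.trans (Finset.sum_le_sum fun i _ => le_of_eq ?_)
  ring

variable [MeasurableSpace Ω] {μ : Measure Ω} {M : Market d Ω}
  {B xmax amin amax bmax lam : ℝ} {σ : ℝ≥0}

theorem Market.Model.measurable_inGroup (hM : M.Model μ B σ) (j : Fin 2) (i : ℕ) :
    Measurable (M.inGroup j i) :=
  (Measurable.of_discrete (f := fun g : Fin 2 => if g = j then (1 : ℝ) else 0)).comp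
    (hM.measurable_G i)

theorem Market.Model.measurable_regr (hM : M.Model μ B σ) (i : ℕ) (k : Fin (d + 2)) :
    Measurable fun ω => M.regr i ω k :=
  measurable_regressor (hM.measurable_U i) (hM.measurable_X i) k

theorem Market.Model.measurable_gramTerm (hM : M.Model μ B σ) (j : Fin 2) (k l : Fin (d + 2))
    (i : ℕ) : Measurable (M.gramTerm j k l i) :=
  (hM.measurable_inGroup j i).mul ((hM.measurable_regr i k).mul (hM.measurable_regr i l))

theorem Market.Model.measurable_scoreTerm (hM : M.Model μ B σ) (j : Fin 2) (k : Fin (d + 2))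
    (i : ℕ) : Measurable (M.scoreTerm j k i) :=
  (hM.measurable_inGroup j i).mul ((hM.measurable_noise i).mul (hM.measurable_regr i k))

theorem Market.Model.groupProb_pos (hM : M.Model μ B σ) (j : Fin 2) : 0 < M.groupProb j := by
  unfold Market.groupProb
  split_ifs
  · exact hM.q_mem.1
  · exact sub_pos.2 hM.q_mem.2

theorem Market.Bounded.sum_regr_sq_le (hM : M.Model μ B σ) (hb : M.Bounded μ xmax amin amax bmax)
    (i : ℕ) : ∀ᵐ ω ∂μ, ∑ k, M.regr i ω k ^ 2 ≤ B ^ 2 + (1 + xmax ^ 2) := by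
  filter_upwards [hM.price_mem i, hb.features i] with ω hU hX
  rw [Market.regr, sum_regressor_sq]
  have := hU.1.le
  have := hU.2.le
  gcongr

theorem Market.Model.pairwise_indepFun (hM : M.Model μ B σ)
    {f : Feature d × Fin 2 × ℝ × ℝ → ℝ} (hf : Measurable f) :
    Pairwise fun i i' => IndepFun (fun ω => f (M.X i ω, M.G i ω, M.U i ω, M.noise i ω))
      (fun ω => f (M.X i' ω, M.G i' ω, M.U i' ω, M.noise i' ω)) μ :=
  fun _ _ h => (hM.indep_rounds.indepFun h).comp hf hf

theorem Market.Model.pairwise_indepFun_gramTerm (hM : M.Model μ B σ) (j : Fin 2)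
    (k l : Fin (d + 2)) :
    Pairwise fun i i' => IndepFun (M.gramTerm j k l i) (M.gramTerm j k l i') μ := by
  refine hM.pairwise_indepFun (f := fun a => (if a.2.1 = j then 1 else 0)
    * (regressor a.2.2.1 a.1 k * regressor a.2.2.1 a.1 l)) ?_
  have h : ∀ k, Measurable fun a : Feature d × Fin 2 × ℝ × ℝ => regressor a.2.2.1 a.1 k :=
    fun k => measurable_regressor (by fun_prop) (by fun_prop) k
  exact ((Measurable.of_discrete (f := fun g : Fin 2 => if g = j then (1 : ℝ) else 0)).comp
    (by fun_prop)).mul ((h k).mul (h l))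

theorem Market.Model.pairwise_indepFun_scoreTerm (hM : M.Model μ B σ) (j : Fin 2)
    (k : Fin (d + 2)) :
    Pairwise fun i i' => IndepFun (M.scoreTerm j k i) (M.scoreTerm j k i') μ := by
  refine hM.pairwise_indepFun (f := fun a => (if a.2.1 = j then 1 else 0)
    * (a.2.2.2 * regressor a.2.2.1 a.1 k)) ?_
  have h : Measurable fun a : Feature d × Fin 2 × ℝ × ℝ => regressor a.2.2.1 a.1 k :=
    measurable_regressor (by fun_prop) (by fun_prop) k
  exact ((Measurable.of_discrete (f := fun g : Fin 2 => if g = j then (1 : ℝ) else 0)).comp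
    (by fun_prop)).mul (Measurable.mul (by fun_prop) h)

theorem Market.Bounded.abs_regr_le (hM : M.Model μ B σ) (hb : M.Bounded μ xmax amin amax bmax)
    (i : ℕ) : ∀ᵐ ω ∂μ, ∀ k, |M.regr i ω k| ≤ √(B ^ 2 + (1 + xmax ^ 2)) := by
  filter_upwards [hb.sum_regr_sq_le hM i] with ω h k
  refine Real.abs_le_sqrt (le_trans ?_ h)
  exact Finset.single_le_sum (f := fun k => M.regr i ω k ^ 2) (fun _ _ => sq_nonneg _)
    (Finset.mem_univ k)

theorem Market.Model.measurable_exploreData (hM : M.Model μ B σ) (n : ℕ) :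
    Measurable (M.exploreData n) := by
  refine measurable_pi_iff.2 fun i => ?_
  have hX := hM.measurable_X i
  have hU := hM.measurable_U i
  have hN := hM.measurable_noise i
  have hα : Measurable fun ω => (M.θ (M.G i ω)).1 :=
    (Measurable.of_discrete (f := fun g : Fin 2 => (M.θ g).1)).comp (hM.measurable_G i)
  have hβ : ∀ k, Measurable fun ω => (M.θ (M.G i ω)).2 k := fun k =>
    (Measurable.of_discrete (f := fun g : Fin 2 => (M.θ g).2 k)).comp (hM.measurable_G i)
  have hlin : Measurable fun ω => lin (M.θ (M.G i ω)).2 (M.X i ω) :=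
    (hβ 0).add (Finset.measurable_sum _ fun k _ => (hβ k.succ).mul (by fun_prop))
  exact hX.prodMk ((hM.measurable_G i).prodMk (hU.prodMk (((hα.mul hU).add hlin).add hN)))

theorem Market.Bounded.memLp_noise_mul_regr (hM : M.Model μ B σ)
    (hb : M.Bounded μ xmax amin amax bmax) (i : ℕ) (k : Fin (d + 2)) :
    MemLp (fun ω => M.noise i ω * M.regr i ω k) 2 μ := by
  refine ((hM.subgaussian i).memLp 2).of_le_mul (c := √(B ^ 2 + (1 + xmax ^ 2)))
    ((hM.measurable_noise i).mul (hM.measurable_regr i k)).aestronglyMeasurable ?_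
  filter_upwards [hb.abs_regr_le hM i] with ω h
  rw [norm_mul, mul_comm]
  exact mul_le_mul_of_nonneg_right (h k) (norm_nonneg _)

theorem Market.Bounded.memLp_scoreTerm (hM : M.Model μ B σ) (hb : M.Bounded μ xmax amin amax bmax)
    (j : Fin 2) (k : Fin (d + 2)) (i : ℕ) : MemLp (M.scoreTerm j k i) 2 μ := by
  refine (hb.memLp_noise_mul_regr hM i k).of_le_mul (c := 1)
    (hM.measurable_scoreTerm j k i).aestronglyMeasurable (.of_forall fun ω => ?_)
  rw [Market.scoreTerm, norm_mul]
  exact mul_le_mul_of_nonneg_right (M.abs_inGroup_le j i ω) (norm_nonneg _)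

variable [IsProbabilityMeasure μ]

theorem Market.Model.integral_inGroup (hM : M.Model μ B σ) (j : Fin 2) (i : ℕ) :
    ∫ ω, M.inGroup j i ω ∂μ = M.groupProb j := by
  have hset : ∀ j, MeasurableSet {ω | M.G i ω = j} := fun j =>
    hM.measurable_G i (measurableSet_singleton j)
  have h : ∫ ω, M.inGroup j i ω ∂μ = μ.real {ω | M.G i ω = j} := by
    rw [← integral_indicator_one (hset j)]
    refine integral_congr_ae (.of_forall fun ω => ?_)
    simp [Market.inGroup, Set.indicator_apply]
  rw [h, Market.groupProb]
  split_ifs with h0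
  · rw [h0, hM.prob_G i]
  · rw [← hM.prob_G i, ← probReal_compl_eq_one_sub (hset 0)]
    congr 1
    ext ω
    simp only [Set.mem_ofPred_eq, Set.mem_compl_iff]
    generalize M.G i ω = g
    omega

theorem Market.Model.integral_inGroup_mul (hM : M.Model μ B σ) (j : Fin 2) (i : ℕ)
    {f : Feature d × ℝ × ℝ → ℝ} (hf : Measurable f) :
    ∫ ω, M.inGroup j i ω * f (M.X i ω, M.U i ω, M.noise i ω) ∂μ
      = M.groupProb j * ∫ ω, f (M.X i ω, M.U i ω, M.noise i ω) ∂μ := by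
  rw [← hM.integral_inGroup j i]
  exact (hM.indep_group i).integral_fun_comp_mul_comp
    (f := fun g : Fin 2 => if g = j then (1 : ℝ) else 0) (hM.measurable_G i).aemeasurable
    ((hM.measurable_X i).prodMk ((hM.measurable_U i).prodMk (hM.measurable_noise i))).aemeasurable
    Measurable.of_discrete.aestronglyMeasurable hf.aestronglyMeasurable

theorem Market.Bounded.memLp_regr (hM : M.Model μ B σ) (hb : M.Bounded μ xmax amin amax bmax)
    (i : ℕ) (k : Fin (d + 2)) : MemLp (fun ω => M.regr i ω k) 2 μ :=
  MemLp.of_bound (hM.measurable_regr i k).aestronglyMeasurable _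
    ((hb.abs_regr_le hM i).mono fun _ h => h k)

theorem Market.Bounded.memLp_gramTerm (hM : M.Model μ B σ) (hb : M.Bounded μ xmax amin amax bmax)
    (j : Fin 2) (k l : Fin (d + 2)) (i : ℕ) : MemLp (M.gramTerm j k l i) 2 μ := by
  refine MemLp.of_bound (hM.measurable_gramTerm j k l i).aestronglyMeasurable
    (1 * (√(B ^ 2 + (1 + xmax ^ 2)) * √(B ^ 2 + (1 + xmax ^ 2)))) ?_
  filter_upwards [hb.abs_regr_le hM i] with ω h
  rw [Market.gramTerm, norm_mul, norm_mul]
  exact mul_le_mul (M.abs_inGroup_le j i ω) (mul_le_mul (h k) (h l) (by positivity)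
    (by positivity)) (by positivity) zero_le_one

/-- The group indicator splits off by independence, and the regression vector is a function of the
variables given which the noise has mean zero. -/
theorem Market.Bounded.integral_scoreTerm (hM : M.Model μ B σ)
    (hb : M.Bounded μ xmax amin amax bmax) (j : Fin 2) (k : Fin (d + 2)) (i : ℕ) :
    ∫ ω, M.scoreTerm j k i ω ∂μ = 0 := by
  have hf : Measurable fun a : Feature d × ℝ × ℝ => a.2.2 * regressor a.2.1 a.1 k :=
    Measurable.mul (by fun_prop) (measurable_regressor (by fun_prop) (by fun_prop) k)
  refine (hM.integral_inGroup_mul j i hf).trans ?_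
  refine mul_eq_zero_of_right _ (integral_mul_eq_zero_of_condExp
    ((hM.measurable_X i).prodMk (hM.measurable_U i)).comap_le ?_
    ((hb.memLp_noise_mul_regr hM i k).integrable one_le_two)
    (((hM.subgaussian i).memLp 1).integrable le_rfl) (hM.noise_mean i))
  have h : Measurable[MeasurableSpace.comap (fun ω => (M.X i ω, M.U i ω)) inferInstance]
      fun ω => (M.X i ω, M.U i ω) := comap_measurable _
  exact (measurable_regressor (measurable_snd.comp h) (measurable_fst.comp h) k).stronglyMeasurable

/-- Summing over coordinates inside the integral produces the squared norm of the regression vector,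
which is bounded independently of `d`. The indicator equals its square, so the group probability
enters to the first power. -/
theorem Market.Bounded.sum_integral_scoreTerm_sq_le (hM : M.Model μ B σ)
    (hb : M.Bounded μ xmax amin amax bmax) (j : Fin 2) (i : ℕ) :
    ∑ k, ∫ ω, M.scoreTerm j k i ω ^ 2 ∂μ
      ≤ M.groupProb j * ((B ^ 2 + (1 + xmax ^ 2)) * (4 * Real.exp ((σ : ℝ) ^ 2 / 2))) := by
  have hN : Integrable (fun ω => M.noise i ω ^ 2) μ := ((hM.subgaussian i).memLp 2).integrable_sq
  have hNG : Integrable (fun ω => M.inGroup j i ω * M.noise i ω ^ 2) μ :=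
    hN.bdd_mul (c := 1) (hM.measurable_inGroup j i).aestronglyMeasurable
      (.of_forall fun ω => M.abs_inGroup_le j i ω)
  rw [← integral_finsetSum _ fun k _ => (hb.memLp_scoreTerm hM j k i).integrable_sq]
  calc ∫ ω, ∑ k, M.scoreTerm j k i ω ^ 2 ∂μ
      ≤ ∫ ω, (B ^ 2 + (1 + xmax ^ 2)) * (M.inGroup j i ω * M.noise i ω ^ 2) ∂μ := by
        refine integral_mono_ae
          (integrable_finsetSum _ fun k _ => (hb.memLp_scoreTerm hM j k i).integrable_sq)
          (hNG.const_mul _) ?_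
        filter_upwards [hb.sum_regr_sq_le hM i] with ω h
        have e : ∑ k, M.scoreTerm j k i ω ^ 2
            = (∑ k, M.regr i ω k ^ 2) * (M.inGroup j i ω * M.noise i ω ^ 2) := by
          rw [Finset.sum_mul]
          refine Finset.sum_congr rfl fun k _ => ?_
          rw [Market.scoreTerm, mul_pow, M.inGroup_sq]
          ring
        rw [e]
        exact mul_le_mul_of_nonneg_right h (mul_nonneg (M.inGroup_nonneg j i ω) (sq_nonneg _))
    _ = M.groupProb j * ((B ^ 2 + (1 + xmax ^ 2)) * ∫ ω, M.noise i ω ^ 2 ∂μ) := by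
        rw [integral_const_mul, hM.integral_inGroup_mul j i (f := fun a => a.2.2 ^ 2) (by fun_prop)]
        ring
    _ ≤ _ := by
        have := integral_sq_le_of_hasSubgaussianMGF (hM.subgaussian i)
        have hg := hM.groupProb_pos j
        push_cast at this
        gcongr

/-- The squared Frobenius norm of `z zᵀ` is `|z|⁴`, again bounded independently of `d`. -/
theorem Market.Bounded.sum_integral_gramTerm_sq_le (hM : M.Model μ B σ)
    (hb : M.Bounded μ xmax amin amax bmax) (j : Fin 2) (i : ℕ) :
    ∑ k, ∑ l, ∫ ω, M.gramTerm j k l i ω ^ 2 ∂μ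
      ≤ M.groupProb j * (B ^ 2 + (1 + xmax ^ 2)) ^ 2 := by
  have hint : ∀ k l, Integrable (fun ω => M.gramTerm j k l i ω ^ 2) μ := fun k l =>
    (hb.memLp_gramTerm hM j k l i).integrable_sq
  have hG : Integrable (M.inGroup j i) μ :=
    Integrable.of_bound (hM.measurable_inGroup j i).aestronglyMeasurable 1
      (.of_forall fun ω => M.abs_inGroup_le j i ω)
  have hswap : ∑ k, ∑ l, ∫ ω, M.gramTerm j k l i ω ^ 2 ∂μ
      = ∫ ω, ∑ k, ∑ l, M.gramTerm j k l i ω ^ 2 ∂μ := by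
    rw [integral_finsetSum _ fun k _ => integrable_finsetSum _ fun l _ => hint k l]
    exact Finset.sum_congr rfl fun k _ => (integral_finsetSum _ fun l _ => hint k l).symm
  rw [hswap, ← hM.integral_inGroup j i, ← integral_mul_const]
  refine integral_mono_ae
    (integrable_finsetSum _ fun k _ => integrable_finsetSum _ fun l _ => hint k l)
    (hG.mul_const _) ?_
  filter_upwards [hb.sum_regr_sq_le hM i] with ω h
  have e : ∑ k, ∑ l, M.gramTerm j k l i ω ^ 2
      = M.inGroup j i ω * (∑ k, M.regr i ω k ^ 2) ^ 2 := by
    rw [sq (∑ k, _), Finset.sum_mul_sum]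
    simp only [Finset.mul_sum, Market.gramTerm, mul_pow, M.inGroup_sq]
  rw [e]
  exact mul_le_mul_of_nonneg_left
    (pow_le_pow_left₀ (Finset.sum_nonneg fun _ _ => sq_nonneg _) h 2) (M.inGroup_nonneg j i ω)

/-- The expected Gram matrix of a group is well conditioned. -/
theorem Market.EigenBound.gram_lower (hM : M.Model μ B σ) (hB : 0 < B)
    (hb : M.Bounded μ xmax amin amax bmax) (he : M.EigenBound μ lam) (j : Fin 2) (n : ℕ)
    (v : Fin (d + 2) → ℝ) :
    n * M.groupProb j * min (B ^ 2 / (12 + 4 * B ^ 2)) lam * ∑ k, v k ^ 2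
      ≤ ∑ k, ∑ l, (∑ i ∈ Finset.range n, ∫ ω, M.gramTerm j k l i ω ∂μ) * (v k * v l) := by
  have hround : ∀ i, ∑ k, ∑ l, (∫ ω, M.gramTerm j k l i ω ∂μ) * (v k * v l)
      = M.groupProb j * ∫ ω, (∑ k, v k * M.regr i ω k) ^ 2 ∂μ := fun i => by
    have hint : ∀ k l, Integrable (fun ω => v k * M.regr i ω k * (v l * M.regr i ω l)) μ :=
      fun k l => ((hb.memLp_regr hM i k).const_mul (v k)).integrable_mul
        ((hb.memLp_regr hM i l).const_mul (v l))
    simp only [sq, Finset.sum_mul_sum]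
    rw [integral_finsetSum _ fun k _ => integrable_finsetSum _ fun l _ => hint k l, Finset.mul_sum]
    refine Finset.sum_congr rfl fun k _ => ?_
    rw [integral_finsetSum _ fun l _ => hint k l, Finset.mul_sum]
    refine Finset.sum_congr rfl fun l _ => ?_
    have hf : Measurable fun a : Feature d × ℝ × ℝ =>
        v k * regressor a.2.1 a.1 k * (v l * regressor a.2.1 a.1 l) :=
      ((measurable_regressor (by fun_prop) (by fun_prop) k).const_mul _).mul
        ((measurable_regressor (by fun_prop) (by fun_prop) l).const_mul _)
    refine Eq.trans ?_ (hM.integral_inGroup_mul j i hf)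
    rw [← integral_mul_const]
    refine integral_congr_ae (.of_forall fun ω => ?_)
    simp only [Market.gramTerm, Market.regr]
    ring
  have hsum : ∑ k, ∑ l, (∑ i ∈ Finset.range n, ∫ ω, M.gramTerm j k l i ω ∂μ) * (v k * v l)
      = ∑ i ∈ Finset.range n, M.groupProb j * ∫ ω, (∑ k, v k * M.regr i ω k) ^ 2 ∂μ := by
    simp only [← hround, Finset.sum_mul]
    rw [Finset.sum_congr rfl fun k _ => Finset.sum_comm, Finset.sum_comm]
  rw [hsum, mul_assoc, mul_assoc]
  have := Finset.card_nsmul_le_sum (Finset.range n)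
    (fun i => M.groupProb j * ∫ ω, (∑ k, v k * M.regr i ω k) ^ 2 ∂μ)
    (M.groupProb j * (min (B ^ 2 / (12 + 4 * B ^ 2)) lam * ∑ k, v k ^ 2))
    fun i _ => mul_le_mul_of_nonneg_left (he.regressor_lower hM hB hb i v)
      (hM.groupProb_pos j).le
  simpa using this

theorem measurable_paramDist (θ' : Param d) : Measurable fun θ : Param d => paramDist θ θ' := by
  unfold paramDist
  fun_prop

/-- Mean squared error of the least squares estimator after `n` exploration rounds. -/
theorem Market.EigenBound.integral_paramDist_le (hM : M.Model μ B σ) (hB : 0 < B)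
    (hlam : 0 < lam) (hb : M.Bounded μ xmax amin amax bmax) (he : M.EigenBound μ lam)
    {est : (n : ℕ) → (Fin n → Obs d) → Fin 2 → Param d}
    (hest : IsLeastSquares (paramSet d amin amax bmax) est) {n : ℕ} (hn : 0 < n) (j : Fin 2) :
    ∫ ω, paramDist (est n (M.exploreData n ω) j) (M.θ j) ∂μ
      ≤ (32 * ((B ^ 2 + (1 + xmax ^ 2)) * Real.exp ((σ : ℝ) ^ 2 / 2))
          + 2 * (amax ^ 2 + (2 * bmax) ^ 2) * (B ^ 2 + (1 + xmax ^ 2)) ^ 2)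
        / min (B ^ 2 / (12 + 4 * B ^ 2)) lam ^ 2 / (n * M.groupProb j) := by
  set c := min (B ^ 2 / (12 + 4 * B ^ 2)) lam
  set R := amax ^ 2 + (2 * bmax) ^ 2
  set Z := B ^ 2 + (1 + xmax ^ 2)
  have hc : 0 < c := lt_min (by positivity) hlam
  have hg := hM.groupProb_pos j
  have hn' : (0 : ℝ) < n := Nat.cast_pos.2 hn
  have hR : 0 ≤ R := by positivity
  set N : Ω → ℝ := fun ω => paramDist (est n (M.exploreData n ω) j) (M.θ j)
  have hNint : Integrable N μ := by
    refine Integrable.of_bound (((measurable_paramDist (M.θ j)).comp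
      ((hest.1 n j).comp (hM.measurable_exploreData n))).aestronglyMeasurable) R
      (.of_forall fun ω => ?_)
    rw [Real.norm_eq_abs, abs_of_nonneg (paramDist_nonneg _ _)]
    exact paramDist_le (hest.2 n _ j).1 (hb.params j)
  -- Holds for every outcome: no event on which the empirical Gram matrix is invertible has to be
  -- singled out.
  have hpoint : ∀ ω, (n * M.groupProb j * c) ^ 2 * N ω
      ≤ 8 * ∑ k, (∑ i ∈ Finset.range n, M.scoreTerm j k i ω) ^ 2
        + 2 * R * ∑ k, ∑ l, (∑ i ∈ Finset.range n, M.gramTerm j k l i ω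
          - ∑ i ∈ Finset.range n, ∫ ω', M.gramTerm j k l i ω' ∂μ) ^ 2 := by
    intro ω
    obtain ⟨hmem, hmin⟩ := hest.2 n (M.exploreData n ω) j
    have hdist := paramDist_le hmem (hb.params j)
    have hbasic := M.basic_inequality (hmin _ (hb.params j))
    have hlow := he.gram_lower hM hB hb j n
      fun k => coeffs (est n (M.exploreData n ω) j) k - coeffs (M.θ j) k
    have key := sq_mul_sum_sq_le
      (E := fun k l => ∑ i ∈ Finset.range n, ∫ ω', M.gramTerm j k l i ω' ∂μ
        - ∑ i ∈ Finset.range n, M.gramTerm j k l i ω)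
      (W := fun k => ∑ i ∈ Finset.range n, M.scoreTerm j k i ω)
      (v := fun k => coeffs (est n (M.exploreData n ω) j) k - coeffs (M.θ j) k)
      (c := n * M.groupProb j * c) (R := R) (by positivity)
      (by rw [sum_coeffs_sub_sq]; exact hdist) (by
        simp only [sub_mul, Finset.sum_sub_distrib]
        simp only [sub_mul, Finset.sum_sub_distrib] at hlow hbasic
        linarith)
    rw [sum_coeffs_sub_sq] at key
    simp only [sub_sq_comm (∑ i ∈ Finset.range n, M.gramTerm j _ _ i ω)]
    exact key
  have hscoreMem : ∀ k, MemLp (fun ω => ∑ i ∈ Finset.range n, M.scoreTerm j k i ω) 2 μ :=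
    fun k => memLp_finsetSum _ fun i _ => hb.memLp_scoreTerm hM j k i
  have hgramMem : ∀ k l, MemLp (fun ω => ∑ i ∈ Finset.range n, M.gramTerm j k l i ω
      - ∑ i ∈ Finset.range n, ∫ ω', M.gramTerm j k l i ω' ∂μ) 2 μ := fun k l =>
    (memLp_finsetSum _ fun i _ => hb.memLp_gramTerm hM j k l i).sub (memLp_const _)
  have hscore : ∫ ω, ∑ k, (∑ i ∈ Finset.range n, M.scoreTerm j k i ω) ^ 2 ∂μ
      ≤ n * M.groupProb j * (Z * (4 * Real.exp ((σ : ℝ) ^ 2 / 2))) := by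
    rw [integral_finsetSum _ fun k _ => (hscoreMem k).integrable_sq]
    calc _ ≤ ∑ k, ∑ i ∈ Finset.range n, ∫ ω, M.scoreTerm j k i ω ^ 2 ∂μ := by
          -- The score terms are centred, so the variance bound applies to their plain sum.
          refine Finset.sum_le_sum fun k _ => ?_
          have := integral_sum_sub_sq_le (fun i => hb.memLp_scoreTerm hM j k i)
            (hM.pairwise_indepFun_scoreTerm j k) n
          simpa only [hb.integral_scoreTerm hM, Finset.sum_const_zero, sub_zero] using this
      _ = ∑ i ∈ Finset.range n, ∑ k, ∫ ω, M.scoreTerm j k i ω ^ 2 ∂μ := Finset.sum_comm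
      _ ≤ _ := by
          refine (Finset.sum_le_card_nsmul _ _ _ fun i _ =>
            hb.sum_integral_scoreTerm_sq_le hM j i).trans_eq ?_
          simp [Z, mul_assoc]
  have hgram : ∫ ω, ∑ k, ∑ l, (∑ i ∈ Finset.range n, M.gramTerm j k l i ω
      - ∑ i ∈ Finset.range n, ∫ ω', M.gramTerm j k l i ω' ∂μ) ^ 2 ∂μ
      ≤ n * M.groupProb j * Z ^ 2 := by
    rw [integral_finsetSum _ fun k _ => integrable_finsetSum _ fun l _ =>
      (hgramMem k l).integrable_sq]
    calc _ ≤ ∑ k, ∑ l, ∑ i ∈ Finset.range n, ∫ ω, M.gramTerm j k l i ω ^ 2 ∂μ := by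
          refine Finset.sum_le_sum fun k _ => ?_
          rw [integral_finsetSum _ fun l _ => (hgramMem k l).integrable_sq]
          exact Finset.sum_le_sum fun l _ => integral_sum_sub_sq_le
            (fun i => hb.memLp_gramTerm hM j k l i) (hM.pairwise_indepFun_gramTerm j k l) n
      _ = ∑ i ∈ Finset.range n, ∑ k, ∑ l, ∫ ω, M.gramTerm j k l i ω ^ 2 ∂μ := by
          rw [Finset.sum_congr rfl fun k _ => Finset.sum_comm, Finset.sum_comm]
      _ ≤ _ := by
          refine (Finset.sum_le_card_nsmul _ _ _ fun i _ =>
            hb.sum_integral_gramTerm_sq_le hM j i).trans_eq ?_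
          simp [Z, mul_assoc]
  have iscore : Integrable (fun ω => ∑ k, (∑ i ∈ Finset.range n, M.scoreTerm j k i ω) ^ 2) μ :=
    integrable_finsetSum _ fun k _ => (hscoreMem k).integrable_sq
  have igram : Integrable (fun ω => ∑ k, ∑ l, (∑ i ∈ Finset.range n, M.gramTerm j k l i ω
      - ∑ i ∈ Finset.range n, ∫ ω', M.gramTerm j k l i ω' ∂μ) ^ 2) μ :=
    integrable_finsetSum _ fun k _ => integrable_finsetSum _ fun l _ =>
      (hgramMem k l).integrable_sq
  have hmain := integral_mono (hNint.const_mul ((n * M.groupProb j * c) ^ 2))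
    ((iscore.const_mul 8).add (igram.const_mul (2 * R))) hpoint
  rw [integral_const_mul, integral_add' (iscore.const_mul 8) (igram.const_mul (2 * R)),
    integral_const_mul, integral_const_mul] at hmain
  rw [div_div, le_div_iff₀ (by positivity)]
  have hnp : 0 < n * M.groupProb j := mul_pos hn' hg
  refine le_of_mul_le_mul_right ?_ hnp
  have := mul_le_mul_of_nonneg_left hgram (by positivity : 0 ≤ 2 * R)
  linarith

end Estimation

/-! ### Measurability of the policy -/

section Measurability

variable {d : ℕ} {Ω : Type u} {Z : Type v} [MeasurableSpace Ω] [MeasurableSpace Z]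
  {μ : Measure Ω} {M : Market d Ω} {π : Policy d} {L : Learner d Ω Z} {B : ℝ} {σ : ℝ≥0}
  {S : Set (Param d)}

theorem measurable_lin {A : Type*} [MeasurableSpace A] {β : A → Fin (d + 1) → ℝ}
    {x : A → Feature d} (hβ : Measurable β) (hx : Measurable x) :
    Measurable fun a => lin (β a) (x a) := by
  unfold lin
  fun_prop

theorem measurable_revenue (θ : Param d) {A : Type*} [MeasurableSpace A] {p : A → ℝ}
    {x : A → Feature d} (hp : Measurable p) (hx : Measurable x) :
    Measurable fun a => revenue θ (p a) (x a) :=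
  hp.mul ((hp.const_mul _).add (measurable_lin measurable_const hx))

theorem measurable_gap {A : Type*} [MeasurableSpace A] {θ : A → Fin 2 → Param d}
    {x : A → Feature d} (hθ : ∀ j, Measurable fun a => θ a j) (hx : Measurable x) :
    Measurable fun a => gap (θ a) (x a) :=
  ((measurable_lin (hθ 1).snd hx).div ((hθ 1).fst.const_mul 2)).sub
    ((measurable_lin (hθ 0).snd hx).div ((hθ 0).fst.const_mul 2))

theorem measurable_fairPrice (q δ m : ℝ) {A : Type*} [MeasurableSpace A]
    {θ : A → Fin 2 → Param d} {x : A → Feature d} (hθ : ∀ j, Measurable fun a => θ a j)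
    (hx : Measurable x) (j : Fin 2) : Measurable fun a => fairPrice q δ m (θ a) j (x a) := by
  have hl : ∀ j, Measurable fun a => lin (θ a j).2 (x a) := fun j =>
    measurable_lin (hθ j).snd hx
  have hα : ∀ j, Measurable fun a => (θ a j).1 := fun j => (hθ j).fst
  have h0 := hα 0
  have h1 := hα 1
  have l0 := hl 0
  have l1 := hl 1
  have hj := hα j
  have lj := hl j
  refine Measurable.ite (measurableSet_le (measurable_gap hθ hx) measurable_const) ?_ ?_
  · fun_prop
  · fun_prop

theorem measurable_thetaHat (hM : M.Model μ B σ) (hest : IsLeastSquares S π.est) (T : ℕ)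
    (j : Fin 2) : Measurable fun ω => π.thetaHat M T ω j :=
  (hest.1 _ j).comp (hM.measurable_exploreData _)

theorem measurable_price (hM : M.Model μ B σ) (hest : IsLeastSquares S π.est) (T i : ℕ)
    (j : Fin 2) : Measurable fun ω => π.price M T ω j (M.X i ω) :=
  measurable_fairPrice _ _ _ (measurable_thetaHat hM hest T) (hM.measurable_X i) j

/-- Needed because the reported group is itself random; the two values of the index are treated
separately. -/
theorem measurable_price_apply (hM : M.Model μ B σ) (hest : IsLeastSquares S π.est) (T i : ℕ)
    {g : Ω → Fin 2} (hg : Measurable g) :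
    Measurable fun ω => π.price M T ω (g ω) (M.X i ω) := by
  have h : (fun ω => π.price M T ω (g ω) (M.X i ω))
      = fun ω => if g ω = 0 then π.price M T ω 0 (M.X i ω) else π.price M T ω 1 (M.X i ω) := by
    funext ω
    split_ifs with h0
    · rw [h0]
    · rw [show g ω = 1 by omega]
  rw [h]
  exact Measurable.ite (hg (measurableSet_singleton 0)) (measurable_price hM hest T i 0)
    (measurable_price hM hest T i 1)

theorem measurable_report {A : Type*} [MeasurableSpace A] (C₀ : ℝ)
    {phat : A → Fin 2 → Feature d → ℝ} {x : A → Feature d} {g : A → Fin 2}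
    (hp : ∀ j, Measurable fun a => phat a j (x a)) (hg : Measurable g) :
    Measurable fun a => report C₀ (phat a) (x a) (g a) :=
  Measurable.ite ((hg (measurableSet_singleton 0)).inter
    (measurableSet_lt measurable_const ((hp 0).sub (hp 1)))) measurable_const hg

theorem measurable_oracle (hM : M.Model μ B σ) (hL : L.IsMeasurable) {n : ℕ}
    {h : Ω → Fin n → Rec d} (hh : Measurable h) (j : Fin 2) :
    Measurable fun ω => L.oracle n (h ω) (L.seed n ω) j (M.X n ω) :=
  (hL.oracle n j).comp (hh.prodMk ((hL.seed n).prodMk (hM.measurable_X n)))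

theorem measurable_history (hM : M.Model μ B σ) (hest : IsLeastSquares S π.est)
    (hL : L.IsMeasurable) (T n : ℕ) : Measurable fun ω => history M π L T ω n := by
  -- The records and the reports depend on each other: earlier records determine the learned prices,
  -- these the report, and the report the next record.
  induction n with
  | zero => exact measurable_const
  | succ n ih =>
    have hg : Measurable fun ω => report M.C₀ (L.oracle n (history M π L T ω n) (L.seed n ω))
        (M.X n ω) (M.G n ω) :=
      measurable_report M.C₀ (measurable_oracle hM hL ih) (hM.measurable_G n)
    refine measurable_pi_iff.2 fun k => ?_
    refine Fin.lastCases ?_ (fun k => ?_) k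
    · simp only [history, Fin.snoc_last]
      by_cases h : n < π.T₀ T
      · simp only [if_pos h]
        exact (hM.measurable_X n).prodMk ((hM.measurable_G n).prodMk (hM.measurable_U n))
      · simp only [if_neg h]
        exact (hM.measurable_X n).prodMk (hg.prodMk (measurable_price_apply hM hest T n hg))
    · simp only [history, Fin.snoc_castSucc]
      exact (measurable_pi_apply k).comp ih

theorem measurable_learned (hM : M.Model μ B σ) (hest : IsLeastSquares S π.est)
    (hL : L.IsMeasurable) (T i : ℕ) (j : Fin 2) :
    Measurable fun ω => learned M π L T i ω j (M.X i ω) :=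
  measurable_oracle hM hL (measurable_history hM hest hL T i) j

theorem measurable_offered (hM : M.Model μ B σ) (hest : IsLeastSquares S π.est)
    (hL : L.IsMeasurable) (T i : ℕ) (j : Fin 2) :
    Measurable fun ω => offered M π L T i ω j := by
  unfold offered
  by_cases h : i < π.T₀ T
  · simp only [if_pos h]
    exact hM.measurable_U i
  · simp only [if_neg h]
    exact measurable_price_apply hM hest T i
      (measurable_report M.C₀ (measurable_learned hM hest hL T i) measurable_const)

theorem measurable_weightedRevenue (q : ℝ) (θ : Fin 2 → Param d) {A : Type*} [MeasurableSpace A]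
    {p : A → Fin 2 → ℝ} {x : A → Feature d} (hp : ∀ j, Measurable fun a => p a j)
    (hx : Measurable x) : Measurable fun a => weightedRevenue q θ (p a) (x a) :=
  ((measurable_revenue (θ 0) (hp 0) hx).const_mul q).add
    ((measurable_revenue (θ 1) (hp 1) hx).const_mul (1 - q))

end Measurability

/-! ### Boundedness -/

theorem abs_fairPrice_le {d : ℕ} {q δ m amin amax bmax xmax : ℝ} (hq : q ∈ Set.Ioo (0 : ℝ) 1)
    (hδ : 0 ≤ δ) (hamin : 0 < amin) {θ : Fin 2 → Param d}
    (h : ∀ j, θ j ∈ paramSet d amin amax bmax) {x : Feature d} (hx : ‖x‖ ≤ xmax) (j : Fin 2) :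
    |fairPrice q δ m θ j x| ≤ bmax * (1 + xmax) / (2 * amin) + δ := by
  have hn : ∀ j, (θ j).1 < 0 := fun j => (slope_mem (h j)).1
  by_cases hg : gap θ x ≤ δ - m
  · rw [fairPrice_of_gap_le hg]
    linarith [abs_monopolyPrice_le hamin (h j) hx]
  · have hρ := slopeShare_mem hq hn
    have hρ' : 0 ≤ 1 - slopeShare q θ := sub_nonneg.2 hρ.2
    have b0 := abs_le.1 (abs_monopolyPrice_le hamin (h 0) hx)
    have b1 := abs_le.1 (abs_monopolyPrice_le hamin (h 1) hx)
    have hj : j = 0 ∨ j = 1 := by omega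
    rcases hj with rfl | rfl
    · rw [fairPrice_zero_of_lt_gap hq hn hg, tiedPrice, abs_le]
      constructor <;> nlinarith [hρ.1]
    · rw [fairPrice_one_of_lt_gap hg, fairPrice_zero_of_lt_gap hq hn hg, tiedPrice, abs_le]
      constructor <;> nlinarith [hρ.1]

theorem abs_revenue_le {d : ℕ} {amin amax bmax xmax P : ℝ} {θ : Param d}
    (h : θ ∈ paramSet d amin amax bmax) {x : Feature d} (hx : ‖x‖ ≤ xmax) {p : ℝ} (hp : |p| ≤ P) :
    |revenue θ p x| ≤ P * (amax * P + bmax * (1 + xmax)) := by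
  have hP : 0 ≤ P := (abs_nonneg p).trans hp
  have hl := abs_lin_le h.2.2.2 hx
  have hα := h.2.2.1
  rw [revenue, abs_mul]
  refine mul_le_mul hp ((abs_add_le _ _).trans (add_le_add ?_ hl)) (abs_nonneg _) hP
  rw [abs_mul]
  exact mul_le_mul hα hp (abs_nonneg _) ((abs_nonneg _).trans hα)

theorem abs_weightedRevenue_le {d : ℕ} {q r : ℝ} (hq : q ∈ Set.Ioo (0 : ℝ) 1)
    {θ : Fin 2 → Param d} {p : Fin 2 → ℝ} {x : Feature d}
    (h : ∀ j, |revenue (θ j) (p j) x| ≤ r) : |weightedRevenue q θ p x| ≤ r := by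
  have h0 := abs_le.1 (h 0)
  have h1 := abs_le.1 (h 1)
  obtain ⟨hq0, hq1⟩ := hq
  rw [weightedRevenue, abs_le]
  constructor <;> nlinarith

/-! ### Regret of one round -/

section Round

variable {d : ℕ} {Ω : Type u} {Z : Type v} [MeasurableSpace Ω]
  {μ : Measure Ω} {M : Market d Ω} {π : Policy d} {L : Learner d Ω Z}
  {pstar : Feature d → Fin 2 → ℝ} {η err : ℕ → ℝ}
  {B xmax amin amax bmax lam : ℝ} {σ : ℝ≥0}

/-- Two maximizers have the same value, so an arbitrary `pstar`, of which no measurability is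
assumed, can be replaced by the explicit rule. -/
theorem instRegret_eq (hM : M.Model μ B σ) (hb : M.Bounded μ xmax amin amax bmax)
    (hopt : ∀ x, IsFairOptimal M.q M.δ M.θ x (pstar x)) (T i : ℕ) (ω : Ω) :
    instRegret M π L pstar T i ω
      = weightedRevenue M.q M.θ (fun j => fairPrice M.q M.δ 0 M.θ j (M.X i ω)) (M.X i ω)
        - weightedRevenue M.q M.θ (offered M π L T i ω) (M.X i ω) := by
  have hfair := isFairOptimal_fairPrice (δ := M.δ) hM.q_mem
    (fun j => (slope_mem (hb.params j)).1) (M.X i ω)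
  rw [((hopt (M.X i ω)).2 _ hfair.1).antisymm (hfair.2 _ (hopt (M.X i ω)).1)]
  simp only [instRegret, weightedRevenue]
  ring

/-- A bound on prices that covers both phases. -/
noncomputable def priceBound (B xmax amin bmax δ : ℝ) : ℝ :=
  B + (bmax * (1 + xmax) / (2 * amin) + δ)

/-- A bound on the revenue at all prices up to the price bound. -/
noncomputable def revenueBound (B xmax amin amax bmax δ : ℝ) : ℝ :=
  priceBound B xmax amin bmax δ
    * (amax * priceBound B xmax amin bmax δ + bmax * (1 + xmax))

theorem abs_revenue_fairPrice_le (hM : M.Model μ B σ) (hb : M.Bounded μ xmax amin amax bmax)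
    (hB : 0 < B) (hamin : 0 < amin) (hδ : 0 ≤ M.δ) {θ : Fin 2 → Param d}
    (hθ : ∀ j, θ j ∈ paramSet d amin amax bmax) {x : Feature d} (hx : ‖x‖ ≤ xmax) (m : ℝ)
    (j j' : Fin 2) :
    |revenue (M.θ j) (fairPrice M.q M.δ m θ j' x) x| ≤ revenueBound B xmax amin amax bmax M.δ := by
  refine abs_revenue_le (hb.params j) hx ((abs_fairPrice_le hM.q_mem hδ hamin hθ hx j').trans ?_)
  unfold priceBound
  linarith

theorem abs_instRegret_le (hM : M.Model μ B σ) (hb : M.Bounded μ xmax amin amax bmax)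
    (hB : 0 < B) (hamin : 0 < amin) (hbmax : 0 < bmax) (hxmax : 0 < xmax) (hδ : 0 ≤ M.δ)
    (hest : IsLeastSquares (paramSet d amin amax bmax) π.est)
    (hopt : ∀ x, IsFairOptimal M.q M.δ M.θ x (pstar x)) (T i : ℕ) :
    ∀ᵐ ω ∂μ, |instRegret M π L pstar T i ω| ≤ 2 * revenueBound B xmax amin amax bmax M.δ := by
  filter_upwards [hM.price_mem i, hb.features i] with ω hU hX
  rw [instRegret_eq hM hb hopt]
  have h1 := abs_weightedRevenue_le hM.q_mem
    (p := fun j => fairPrice M.q M.δ 0 M.θ j (M.X i ω)) fun j =>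
    abs_revenue_fairPrice_le hM hb hB hamin hδ hb.params hX 0 j j
  have h2 : |weightedRevenue M.q M.θ (offered M π L T i ω) (M.X i ω)|
      ≤ revenueBound B xmax amin amax bmax M.δ := by
    refine abs_weightedRevenue_le hM.q_mem fun j => ?_
    unfold offered
    split_ifs with h
    · refine abs_revenue_le (hb.params j) hX ?_
      have : 0 ≤ bmax * (1 + xmax) / (2 * amin) := by positivity
      rw [abs_of_pos hU.1, priceBound]
      linarith [hU.2]
    · exact abs_revenue_fairPrice_le hM hb hB hamin hδ (fun j => (hest.2 _ _ j).1) hX _ j _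
  exact (abs_sub _ _).trans (by linarith)

/-- The coefficient of the estimation error in the regret of one round. -/
noncomputable def lossFactor (xmax amin amax bmax δ : ℝ) : ℝ :=
  amax * (10 * ((bmax * (1 + xmax)) ^ 2 / (2 * amin ^ 4) + (1 + xmax ^ 2) / (2 * amin ^ 2))
    + 4 * (bmax * (1 + xmax) / amin + δ) ^ 2 * (amax ^ 2 / amin ^ 4))

/-- The coefficient in the mean squared estimation error. -/
noncomputable def errorFactor (B xmax amax bmax lam : ℝ) (σ : ℝ≥0) : ℝ :=
  (32 * ((B ^ 2 + (1 + xmax ^ 2)) * Real.exp ((σ : ℝ) ^ 2 / 2))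
    + 2 * (amax ^ 2 + (2 * bmax) ^ 2) * (B ^ 2 + (1 + xmax ^ 2)) ^ 2)
    / min (B ^ 2 / (12 + 4 * B ^ 2)) lam ^ 2

/-- The safety margin after `n` exploration rounds. -/
noncomputable def margin (c : ℝ) (n : ℕ) : ℝ := c * √(Real.log n / (n : ℝ))

/-- The three terms are the estimation error, the margin and the misreport. A misreport changes only
the price of group `0`, which costs at most twice the revenue bound with weight `q`. -/
theorem instRegret_le (hM : M.Model μ B σ) (hb : M.Bounded μ xmax amin amax bmax)
    (hB : 0 < B) (hamin : 0 < amin) (hamax : 0 < amax) (hδ : 0 ≤ M.δ)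
    (hest : IsLeastSquares (paramSet d amin amax bmax) π.est)
    (hopt : ∀ x, IsFairOptimal M.q M.δ M.θ x (pstar x)) {T i : ℕ} (hi : π.T₀ T ≤ i) :
    ∀ᵐ ω ∂μ, instRegret M π L pstar T i ω
      ≤ lossFactor xmax amin amax bmax M.δ
          * (paramDist (π.thetaHat M T ω 0) (M.θ 0) + paramDist (π.thetaHat M T ω 1) (M.θ 1))
        + 4 * amax * margin π.cδ (π.T₀ T) ^ 2
          * Set.indicator {ω | 0 < M.δ - gap M.θ (M.X i ω)
            ∧ M.δ - gap M.θ (M.X i ω) ≤ 2 * margin π.cδ (π.T₀ T)} (fun _ => (1 : ℝ)) ω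
        + 2 * revenueBound B xmax amin amax bmax M.δ * M.q
          * Set.indicator {ω | M.C₀ < learned M π L T i ω 0 (M.X i ω)
            - learned M π L T i ω 1 (M.X i ω)} (fun _ => (1 : ℝ)) ω := by
  filter_upwards [hb.features i] with ω hX
  have hθ : ∀ j, π.thetaHat M T ω j ∈ paramSet d amin amax bmax := fun j => (hest.2 _ _ j).1
  have hloss := weightedRevenue_fairPrice_sub_le (m := margin π.cδ (π.T₀ T)) hM.q_mem hδ hamin
    hamax hb.params hθ hX
  have hrep : weightedRevenue M.q M.θ
        (fun j => fairPrice M.q M.δ (margin π.cδ (π.T₀ T)) (π.thetaHat M T ω) j (M.X i ω)) (M.X i ω)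
      - weightedRevenue M.q M.θ (offered M π L T i ω) (M.X i ω)
      ≤ 2 * revenueBound B xmax amin amax bmax M.δ * M.q
          * Set.indicator {ω | M.C₀ < learned M π L T i ω 0 (M.X i ω)
            - learned M π L T i ω 1 (M.X i ω)} (fun _ => (1 : ℝ)) ω := by
    have hoff : ∀ j, offered M π L T i ω j = fairPrice M.q M.δ (margin π.cδ (π.T₀ T))
        (π.thetaHat M T ω) (report M.C₀ (learned M π L T i ω) (M.X i ω) j) (M.X i ω) := fun j => by
      rw [offered, if_neg (not_lt.2 hi), Policy.price, margin]
    simp only [weightedRevenue, hoff]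
    by_cases hc : M.C₀ < learned M π L T i ω 0 (M.X i ω) - learned M π L T i ω 1 (M.X i ω)
    · rw [Set.indicator_of_mem (show ω ∈ {ω | M.C₀ < learned M π L T i ω 0 (M.X i ω)
        - learned M π L T i ω 1 (M.X i ω)} from hc)]
      have h0 : report M.C₀ (learned M π L T i ω) (M.X i ω) 0 = 1 := if_pos ⟨rfl, hc⟩
      have h1 : report M.C₀ (learned M π L T i ω) (M.X i ω) 1 = 1 := if_neg (by simp)
      rw [h0, h1]
      have b0 := abs_le.1 (abs_revenue_fairPrice_le hM hb hB hamin hδ hθ hX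
        (margin π.cδ (π.T₀ T)) 0 0)
      have b1 := abs_le.1 (abs_revenue_fairPrice_le hM hb hB hamin hδ hθ hX
        (margin π.cδ (π.T₀ T)) 0 1)
      linarith [mul_le_mul_of_nonneg_left (sub_le_sub b0.2 b1.1) hM.q_mem.1.le]
    · rw [Set.indicator_of_notMem (show ω ∉ {ω | M.C₀ < learned M π L T i ω 0 (M.X i ω)
        - learned M π L T i ω 1 (M.X i ω)} from hc)]
      have h0 : report M.C₀ (learned M π L T i ω) (M.X i ω) 0 = 0 := if_neg fun h => hc h.2
      have h1 : report M.C₀ (learned M π L T i ω) (M.X i ω) 1 = 1 := if_neg (by simp)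
      rw [h0, h1]
      simp
  rw [instRegret_eq hM hb hopt, lossFactor]
  have hind : Set.indicator {ω | 0 < M.δ - gap M.θ (M.X i ω)
        ∧ M.δ - gap M.θ (M.X i ω) ≤ 2 * margin π.cδ (π.T₀ T)} (fun _ => (1 : ℝ)) ω
      = Set.indicator {y | 0 < M.δ - gap M.θ y ∧ M.δ - gap M.θ y ≤ 2 * margin π.cδ (π.T₀ T)}
        (fun _ => (1 : ℝ)) (M.X i ω) := rfl
  rw [hind]
  linarith

variable [MeasurableSpace Z] [IsProbabilityMeasure μ]

theorem integrable_instRegret (hM : M.Model μ B σ) (hb : M.Bounded μ xmax amin amax bmax)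
    (hB : 0 < B) (hamin : 0 < amin) (hbmax : 0 < bmax) (hxmax : 0 < xmax) (hδ : 0 ≤ M.δ)
    (hest : IsLeastSquares (paramSet d amin amax bmax) π.est) (hL : L.IsMeasurable)
    (hopt : ∀ x, IsFairOptimal M.q M.δ M.θ x (pstar x)) (T i : ℕ) :
    Integrable (instRegret M π L pstar T i) μ := by
  refine Integrable.of_bound (Measurable.aestronglyMeasurable ?_) _
    (abs_instRegret_le hM hb hB hamin hbmax hxmax hδ hest hopt T i)
  rw [funext (instRegret_eq hM hb hopt T i)]
  have hfair : ∀ j, Measurable fun ω => fairPrice M.q M.δ 0 M.θ j (M.X i ω) :=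
    measurable_fairPrice M.q M.δ 0 (θ := fun _ => M.θ) (fun _ => measurable_const)
      (hM.measurable_X i)
  exact (measurable_weightedRevenue M.q M.θ
    (p := fun ω j => fairPrice M.q M.δ 0 M.θ j (M.X i ω)) hfair (hM.measurable_X i)).sub
    (measurable_weightedRevenue M.q M.θ (p := offered M π L T i)
      (measurable_offered hM hest hL T i) (hM.measurable_X i))

/-- A buyer misreports only if one of the learned prices is inaccurate. -/
theorem measureReal_misreport_le (hM : M.Model μ B σ)
    (hest : IsLeastSquares (paramSet d amin amax bmax) π.est) (hL : L.IsMeasurable)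
    (hG : L.Guarantee μ M π η err) (hcδ : 0 ≤ π.cδ) {T i : ℕ} (hi : π.T₀ T ≤ i) (hiT : i < T)
    (herr : err i ≤ (M.C₀ - M.δ) / 2) :
    μ.real {ω | M.C₀ < learned M π L T i ω 0 (M.X i ω) - learned M π L T i ω 1 (M.X i ω)}
      ≤ 2 * η i := by
  set acc : Fin 2 → Set Ω := fun j => {ω |
    |learned M π L T i ω j (M.X i ω) - π.price M T ω j (M.X i ω)| ≤ err i}
  have hacc : ∀ j, μ.real (acc j)ᶜ ≤ η i := fun j => by
    have hm : MeasurableSet (acc j) :=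
      measurableSet_le (_root_.continuous_abs.measurable.comp
        ((measurable_learned hM hest hL T i j).sub (measurable_price hM hest T i j)))
        measurable_const
    rw [probReal_compl_eq_one_sub hm]
    linarith [hG.accuracy T i hi hiT j]
  calc _ ≤ μ.real ((acc 0)ᶜ ∪ (acc 1)ᶜ) := by
        refine measureReal_mono fun ω hω => ?_
        by_contra hc
        simp only [Set.mem_union, Set.mem_compl_iff, not_or, not_not] at hc
        have h0 := abs_le.1 (show _ ≤ err i from hc.1)
        have h1 := abs_le.1 (show _ ≤ err i from hc.2)
        -- Posted prices differ by at most `δ`; two errors of at most `(C₀ - δ) / 2` keep the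
        -- learned difference at most `C₀`.
        have hd := fairPrice_sub_le (q := M.q) (δ := M.δ)
          (mul_nonneg hcδ (Real.sqrt_nonneg (Real.log (π.T₀ T) / (π.T₀ T : ℝ))))
          (π.thetaHat M T ω) (M.X i ω)
        have hω' : M.C₀ < learned M π L T i ω 0 (M.X i ω) - learned M π L T i ω 1 (M.X i ω) := hω
        simp only [Policy.price] at h0 h1
        linarith
    _ ≤ μ.real (acc 0)ᶜ + μ.real (acc 1)ᶜ := measureReal_union_le _ _
    _ ≤ 2 * η i := by linarith [hacc 0, hacc 1]

theorem integral_instRegret_le (hM : M.Model μ B σ) (hb : M.Bounded μ xmax amin amax bmax)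
    (he : M.EigenBound μ lam) (hB : 0 < B) (hlam : 0 < lam) (hamin : 0 < amin) (hamax : 0 < amax)
    (hbmax : 0 < bmax) (hxmax : 0 < xmax) (hδ : 0 ≤ M.δ)
    (hest : IsLeastSquares (paramSet d amin amax bmax) π.est) (hL : L.IsMeasurable)
    (hG : L.Guarantee μ M π η err) (hcδ : 0 ≤ π.cδ)
    (hopt : ∀ x, IsFairOptimal M.q M.δ M.θ x (pstar x)) {T i : ℕ} (hT : 0 < π.T₀ T)
    (hi : π.T₀ T ≤ i) (hiT : i < T) (herr : err i ≤ (M.C₀ - M.δ) / 2) :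
    ∫ ω, instRegret M π L pstar T i ω ∂μ
      ≤ lossFactor xmax amin amax bmax M.δ * errorFactor B xmax amax bmax lam σ
          / (π.T₀ T * (M.q * (1 - M.q)))
        + 4 * amax * margin π.cδ (π.T₀ T) ^ 2
          * μ.real {ω | 0 < M.δ - gap M.θ (M.X 0 ω)
            ∧ M.δ - gap M.θ (M.X 0 ω) ≤ 2 * margin π.cδ (π.T₀ T)}
        + 4 * revenueBound B xmax amin amax bmax M.δ * M.q * η i := by
  have hK : 0 ≤ lossFactor xmax amin amax bmax M.δ := by unfold lossFactor; positivity
  have hP : 0 ≤ priceBound B xmax amin bmax M.δ := by unfold priceBound; positivity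
  have hR : 0 ≤ revenueBound B xmax amin amax bmax M.δ := by unfold revenueBound; positivity
  have hN : ∀ j, Integrable (fun ω => paramDist (π.thetaHat M T ω j) (M.θ j)) μ := fun j => by
    refine Integrable.of_bound ((measurable_paramDist (M.θ j)).comp
      (measurable_thetaHat hM hest T j)).aestronglyMeasurable (amax ^ 2 + (2 * bmax) ^ 2)
      (.of_forall fun ω => ?_)
    rw [Real.norm_eq_abs, abs_of_nonneg (paramDist_nonneg _ _)]
    exact paramDist_le (hest.2 _ _ j).1 (hb.params j)
  have hgap : Measurable fun x : Feature d => gap M.θ x :=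
    measurable_gap (fun _ => measurable_const) measurable_id
  have hslab : MeasurableSet {x : Feature d | 0 < M.δ - gap M.θ x
      ∧ M.δ - gap M.θ x ≤ 2 * margin π.cδ (π.T₀ T)} :=
    (measurableSet_lt measurable_const (hgap.const_sub _)).inter
      (measurableSet_le (hgap.const_sub _) measurable_const)
  have hslabΩ : MeasurableSet {ω | 0 < M.δ - gap M.θ (M.X i ω)
      ∧ M.δ - gap M.θ (M.X i ω) ≤ 2 * margin π.cδ (π.T₀ T)} := hM.measurable_X i hslab
  have hmis : MeasurableSet {ω | M.C₀ < learned M π L T i ω 0 (M.X i ω)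
      - learned M π L T i ω 1 (M.X i ω)} :=
    measurableSet_lt measurable_const
      ((measurable_learned hM hest hL T i 0).sub (measurable_learned hM hest hL T i 1))
  -- The margin term may be evaluated at round `0`, where `Market.BoundaryRegular` is stated.
  have hident : μ.real {ω | 0 < M.δ - gap M.θ (M.X i ω)
        ∧ M.δ - gap M.θ (M.X i ω) ≤ 2 * margin π.cδ (π.T₀ T)}
      = μ.real {ω | 0 < M.δ - gap M.θ (M.X 0 ω)
        ∧ M.δ - gap M.θ (M.X 0 ω) ≤ 2 * margin π.cδ (π.T₀ T)} :=
    congrArg ENNReal.toReal ((hM.ident_X i).measure_mem_eq hslab)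
  have i1 := (hN 0).add (hN 1)
  have i2 : Integrable (Set.indicator {ω | 0 < M.δ - gap M.θ (M.X i ω)
      ∧ M.δ - gap M.θ (M.X i ω) ≤ 2 * margin π.cδ (π.T₀ T)} fun _ => (1 : ℝ)) μ :=
    (integrable_const 1).indicator hslabΩ
  have i3 : Integrable (Set.indicator {ω | M.C₀ < learned M π L T i ω 0 (M.X i ω)
      - learned M π L T i ω 1 (M.X i ω)} fun _ => (1 : ℝ)) μ :=
    (integrable_const 1).indicator hmis
  have hmain := integral_mono_ae
    (integrable_instRegret hM hb hB hamin hbmax hxmax hδ hest hL hopt T i)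
    (((i1.const_mul (lossFactor xmax amin amax bmax M.δ)).add
      (i2.const_mul (4 * amax * margin π.cδ (π.T₀ T) ^ 2))).add
      (i3.const_mul (2 * revenueBound B xmax amin amax bmax M.δ * M.q)))
    (instRegret_le hM hb hB hamin hamax hδ hest hopt hi)
  rw [integral_add' ((i1.const_mul _).add (i2.const_mul _)) (i3.const_mul _),
    integral_add' (i1.const_mul _) (i2.const_mul _), integral_const_mul, integral_const_mul,
    integral_const_mul, integral_add' (hN 0) (hN 1), integral_indicator_const _ hslabΩ,
    integral_indicator_const _ hmis, smul_eq_mul, smul_eq_mul, mul_one, mul_one, hident] at hmain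
  refine hmain.trans (add_le_add (add_le_add ?_ le_rfl) ?_)
  -- The errors of the two groups add up through `1 / q + 1 / (1 - q) = 1 / (q (1 - q))`.
  · rw [mul_div_assoc]
    refine mul_le_mul_of_nonneg_left ?_ hK
    have e0 := he.integral_paramDist_le hM hB hlam hb hest hT 0
    have e1 := he.integral_paramDist_le hM hB hlam hb hest hT 1
    refine (add_le_add e0 e1).trans_eq ?_
    rw [← errorFactor]
    have hT' : (π.T₀ T : ℝ) ≠ 0 := Nat.cast_ne_zero.2 hT.ne'
    have hq0 := hM.q_mem.1.ne'
    have hq1 := (sub_pos.2 hM.q_mem.2).ne'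
    simp only [Market.groupProb, if_true, one_ne_zero, if_false]
    field_simp
    ring
  · have := measureReal_misreport_le hM hest hL hG hcδ hi hiT herr
    have hq := hM.q_mem.1
    have := mul_le_mul_of_nonneg_left this
      (by positivity : 0 ≤ 2 * revenueBound B xmax amin amax bmax M.δ * M.q)
    linarith

end Round

/-! ### Long horizons -/

theorem margin_sq_mul (c : ℝ) (n : ℕ) : margin c n ^ 2 * n = c ^ 2 * Real.log n := by
  rcases Nat.eq_zero_or_pos n with rfl | hn
  · simp
  · have hn' : (0 : ℝ) < n := Nat.cast_pos.2 hn
    have : 0 ≤ Real.log n / n := div_nonneg (Real.log_natCast_nonneg n) hn'.le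
    rw [margin, mul_pow, Real.sq_sqrt this]
    field_simp

theorem tendsto_margin (c : ℝ) : Tendsto (fun n : ℕ => margin c n) atTop (𝓝 0) := by
  have h : Tendsto (fun x : ℝ => Real.log x / x) atTop (𝓝 0) := by
    simpa using Real.isLittleO_log_id_atTop.tendsto_div_nhds_zero
  have h' := ((h.comp tendsto_natCast_atTop_atTop).sqrt).const_mul c
  rwa [Real.sqrt_zero, mul_zero] at h'

/-- The logarithm of the sample size is of the order of the logarithm of the inverse margin. -/
theorem eventually_log_le_margin {c : ℝ} (hc : 0 < c) :
    ∀ᶠ n : ℕ in atTop, Real.log n ≤ 4 * Real.log (1 / margin c n) := by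
  -- Eventually `c² log n ≤ √n`, that is `margin² √n ≤ 1`; taking logarithms gives the factor `4`.
  have hlit := (isLittleO_log_rpow_atTop (show (0 : ℝ) < 1 / 2 by norm_num)).def
    (show 0 < 1 / c ^ 2 by positivity)
  filter_upwards [tendsto_natCast_atTop_atTop.eventually hlit, eventually_gt_atTop 1] with n h hn
  have hn1 : (1 : ℝ) < n := by exact_mod_cast hn
  have hn0 : (0 : ℝ) < n := by linarith
  have hlog := Real.log_pos hn1
  rw [← Real.sqrt_eq_rpow, Real.norm_of_nonneg hlog.le, Real.norm_of_nonneg (Real.sqrt_nonneg _),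
    div_mul_eq_mul_div, one_mul, le_div_iff₀ (by positivity)] at h
  have hm : 0 < margin c n := mul_pos hc (Real.sqrt_pos.2 (div_pos hlog hn0))
  have hs := Real.sqrt_pos.2 hn0
  have hsq : margin c n ^ 2 * √n ≤ 1 := by
    refine le_of_mul_le_mul_right ?_ hs
    rw [mul_assoc, Real.mul_self_sqrt hn0.le, margin_sq_mul]
    linarith
  have hl := Real.log_le_log (by positivity) hsq
  rw [Real.log_mul (by positivity) hs.ne', Real.log_pow, Real.log_sqrt hn0.le, Real.log_one] at hl
  rw [one_div, Real.log_inv]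
  push_cast at hl
  linarith

/-- The squared margin times `n` is `c² log n`, and the strip probability is `o` of the reciprocal
of a quantity comparable to `log n`. The little `o` allows the bound `1` whatever `c` is, so the
final constants do not depend on the policy's `cδ`. -/
theorem Market.BoundaryRegular.eventually_margin {d : ℕ} {Ω : Type u} [MeasurableSpace Ω]
    {μ : Measure Ω} {M : Market d Ω} (h : M.BoundaryRegular μ) {c : ℝ} (hc : 0 ≤ c) :
    ∀ᶠ n : ℕ in atTop, 4 * margin c n ^ 2 * μ.real {ω | 0 < M.δ - gap M.θ (M.X 0 ω)
      ∧ M.δ - gap M.θ (M.X 0 ω) ≤ 2 * margin c n} * n ≤ 1 := by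
  -- A zero margin does not approach `0` through positive values and is treated apart; the claim is
  -- then trivial.
  rcases hc.eq_or_lt with rfl | hc
  · refine .of_forall fun n => ?_
    simp [margin]
  have hdouble : ∀ n : ℕ, margin (2 * c) n = 2 * margin c n := fun n => by
    simp only [margin, mul_assoc]
  have htend : Tendsto (fun n : ℕ => margin (2 * c) n) atTop (𝓝[>] 0) := by
    refine tendsto_nhdsWithin_iff.2 ⟨tendsto_margin _, ?_⟩
    filter_upwards [eventually_gt_atTop 1] with n hn
    have hn1 : (1 : ℝ) < n := by exact_mod_cast hn
    exact mul_pos (by positivity)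
      (Real.sqrt_pos.2 (div_pos (Real.log_pos hn1) (zero_lt_one.trans hn1)))
  -- The threshold offsets `4 c²` from the squared margin and `4` from the comparison of logarithms.
  have hsmall := (h.comp htend).eventually (gt_mem_nhds (show 0 < 1 / (16 * c ^ 2) by positivity))
  filter_upwards [hsmall, eventually_log_le_margin (show 0 < 2 * c by positivity)] with n h1 h2
  simp only [Function.comp_apply, hdouble] at h1 h2
  generalize hp : μ.real {ω | 0 < M.δ - gap M.θ (M.X 0 ω)
      ∧ M.δ - gap M.θ (M.X 0 ω) ≤ 2 * margin c n} = p at *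
  have hp0 : 0 ≤ p := hp ▸ measureReal_nonneg
  calc 4 * margin c n ^ 2 * p * n = 4 * c ^ 2 * (Real.log n * p) := by
        rw [← mul_assoc, mul_assoc (4 : ℝ) (c ^ 2), ← margin_sq_mul]; ring
    _ ≤ 4 * c ^ 2 * (4 * Real.log (1 / (2 * margin c n)) * p) := by gcongr
    _ = 16 * c ^ 2 * (Real.log (1 / (2 * margin c n)) * p) := by ring
    _ ≤ 16 * c ^ 2 * (1 / (16 * c ^ 2)) := by gcongr
    _ = 1 := by field_simp

theorem tendsto_explorationLength {d : ℕ} {π : Policy d} (h : 0 < π.τ) :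
    Tendsto (fun T : ℕ => π.T₀ T) atTop atTop := by
  refine tendsto_natCast_atTop_iff (R := ℝ).1 ?_
  refine tendsto_atTop_mono (fun T => Nat.le_ceil _) ?_
  exact (Real.tendsto_sqrt_atTop.comp tendsto_natCast_atTop_atTop).const_mul_atTop h

/-- Splitting the regret at the end of the exploration phase. -/
theorem sum_range_le_of_phases {f g : ℕ → ℝ} {n T : ℕ} {a b : ℝ} (ha : 0 ≤ a) (hb : 0 ≤ b)
    (hg : ∀ i, 0 ≤ g i) (h1 : ∀ i < T, i < n → f i ≤ a) (h2 : ∀ i < T, n ≤ i → f i ≤ b + g i) :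
    ∑ i ∈ Finset.range T, f i ≤ n * a + T * b + ∑ i ∈ Finset.range T, g i := by
  calc ∑ i ∈ Finset.range T, f i
      ≤ ∑ i ∈ Finset.range T, ((if i < n then a else 0) + b + g i) := by
        refine Finset.sum_le_sum fun i hi => ?_
        have hi' := Finset.mem_range.1 hi
        split_ifs with h
        · linarith [h1 i hi' h, hg i]
        · linarith [h2 i hi' (not_lt.1 h)]
    _ ≤ n * a + T * b + ∑ i ∈ Finset.range T, g i := by
        rw [Finset.sum_add_distrib, Finset.sum_add_distrib, Finset.sum_const, Finset.card_range,
          nsmul_eq_mul, ← Finset.sum_filter, Finset.sum_const, nsmul_eq_mul]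
        have hcard : ((Finset.range T).filter (· < n)).card ≤ n := by
          refine (Finset.card_le_card fun i hi => ?_).trans (Finset.card_range n).le
          exact Finset.mem_range.2 (Finset.mem_filter.1 hi).2
        have : (((Finset.range T).filter (· < n)).card : ℝ) ≤ n := by exact_mod_cast hcard
        gcongr

/-- The regret bound in terms of the exploration scale `D = √((d + 2) / (q (1 - q)))`. -/
theorem phase_lengths_le {τ κ₁ κ₂ D w T n r k a : ℝ} (hκ₁ : 0 < κ₁) (hD : 0 < D)
    (hT : 0 < T) (hr : 0 ≤ r) (hk : 0 ≤ k) (ha : 0 ≤ a) (hw : 0 < w) (hw1 : w ≤ 1)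
    (hwD : 1 / w ≤ D ^ 2)
    (hτ₁ : κ₁ * D ≤ τ) (hτ₂ : τ ≤ κ₂ * D) (h1 : 1 ≤ τ * √T) (hn₁ : τ * √T ≤ n)
    (hn₂ : n ≤ τ * √T + 1) :
    n * r + T * (k / (n * w) + a / n) ≤ (2 * κ₂ * r + (k + a) / κ₁) * (D * √T) := by
  have hs := Real.sqrt_pos.2 hT
  have hn : 0 < n := by linarith
  -- The factor `2` in `hup` absorbs the rounding up of `n`, as `1 ≤ τ √T`.
  have hlow : κ₁ * D * √T ≤ n := (mul_le_mul_of_nonneg_right hτ₁ hs.le).trans hn₁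
  have hup : n ≤ 2 * κ₂ * (D * √T) := by
    linarith [mul_le_mul_of_nonneg_right hτ₂ hs.le]
  have hTn : T * (1 / (n * w)) ≤ D * √T / κ₁ := by
    have e : T * (1 / (n * w)) = T * (1 / w) / n := by field_simp
    rw [e]
    calc T * (1 / w) / n ≤ T * D ^ 2 / (κ₁ * D * √T) := by gcongr
      _ = D * √T / κ₁ := by
        nth_rewrite 1 [← Real.mul_self_sqrt hT.le]
        field_simp
  have hka : k / (n * w) + a / n ≤ (k + a) * (1 / (n * w)) := by
    have : a / n ≤ a / (n * w) := by
      gcongr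
      exact mul_le_of_le_one_right hn.le hw1
    rw [mul_one_div, add_div]
    linarith
  calc n * r + T * (k / (n * w) + a / n)
      ≤ 2 * κ₂ * (D * √T) * r + T * ((k + a) * (1 / (n * w))) := by gcongr
    _ = 2 * κ₂ * (D * √T) * r + (k + a) * (T * (1 / (n * w))) := by ring
    _ ≤ 2 * κ₂ * (D * √T) * r + (k + a) * (D * √T / κ₁) := by gcongr
    _ = _ := by ring

end FairPricing

/-! ### The regret bound -/

theorem theorem2 (B xmax amin amax bmax lam δ κ₁ κ₂ : ℝ) (σ : ℝ≥0)
    (hB : 0 < B) (hxmax : 0 < xmax) (hamin : 0 < amin) (hamax : 0 < amax) (hbmax : 0 < bmax)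
    (hlam : 0 < lam) (hδ : 0 ≤ δ) (hκ₁ : 0 < κ₁) (hκ₂ : 0 < κ₂) :
    ∃ c₂ c₃ c₄ c₅ : ℝ, 0 < c₂ ∧ 0 < c₃ ∧ 0 < c₄ ∧ 0 < c₅ ∧
      ∀ (d : ℕ) (Ω : Type u) [MeasurableSpace Ω] (μ : Measure Ω) [IsProbabilityMeasure μ]
        (Z : Type v) [MeasurableSpace Z]
        (M : FairPricing.Market d Ω) (π : FairPricing.Policy d) (L : FairPricing.Learner d Ω Z)
        (pstar : FairPricing.Feature d → Fin 2 → ℝ) (η err : ℕ → ℝ),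
        M.δ = δ → δ < M.C₀ →
        M.Model μ B σ →
        M.Bounded μ xmax amin amax bmax →
        M.EigenBound μ lam →
        M.BoundaryRegular μ →
        0 ≤ π.cδ →
        κ₁ * √(((d : ℝ) + 2) / (M.q * (1 - M.q))) ≤ π.τ →
        π.τ ≤ κ₂ * √(((d : ℝ) + 2) / (M.q * (1 - M.q))) →
        FairPricing.IsLeastSquares (FairPricing.paramSet d amin amax bmax) π.est →
        L.IsMeasurable →
        L.Guarantee μ M π η err →
        (∀ x, FairPricing.IsFairOptimal M.q M.δ M.θ x (pstar x)) →
        ∃ c₁ : ℝ, 0 < c₁ ∧ ∀ T : ℕ, c₁ < (T : ℝ) →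
          (∀ i < T, Integrable (FairPricing.instRegret M π L pstar T i) μ) ∧
          FairPricing.regret μ M π L pstar T
            < √((c₂ * ((d : ℝ) + 2) + c₃) / (M.q * (1 - M.q)) * (T : ℝ))
              + (c₄ + c₅ * M.q) * ∑ t ∈ Finset.Icc 1 T, η (t - 1) := by
  set R := FairPricing.revenueBound B xmax amin amax bmax δ
  set K := FairPricing.lossFactor xmax amin amax bmax δ
  set E := FairPricing.errorFactor B xmax amax bmax lam σ
  have hP : 0 < FairPricing.priceBound B xmax amin bmax δ := by
    unfold FairPricing.priceBound; positivity
  have hR : 0 < R := by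
    simp only [R, FairPricing.revenueBound]; positivity
  have hK : 0 ≤ K := by simp only [K, FairPricing.lossFactor]; positivity
  have hE : 0 ≤ E := by simp only [E, FairPricing.errorFactor]; positivity
  -- The first summand pays for exploration at `2 * R` per round; the second for estimation (`K *
  -- E`) and for the margin (`amax`) during exploitation.
  set A := 2 * κ₂ * (2 * R) + (K * E + amax) / κ₁
  have hA : 0 < A := by positivity
  -- The values `c₃ = 1` and `c₄ = 1` are slack: the former makes the inequality strict, the latter
  -- only adds a nonnegative term.
  refine ⟨A ^ 2, 1, 1, 4 * R, by positivity, one_pos, one_pos, by positivity, ?_⟩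
  intro d Ω _ μ _ Z _ M π L pstar η err hMδ hC₀ hM hb he hreg hcδ hτ₁ hτ₂ hest hL hG hopt
  have hq0 := hM.q_mem.1
  have hq1 := sub_pos.2 hM.q_mem.2
  have hδ' : 0 ≤ M.δ := hMδ.symm ▸ hδ
  have hw : 0 < M.q * (1 - M.q) := mul_pos hq0 hq1
  have hw1 : M.q * (1 - M.q) ≤ 1 := mul_le_one₀ hM.q_mem.2.le hq1.le (sub_le_self 1 hq0.le)
  have hd : (0 : ℝ) ≤ d := Nat.cast_nonneg d
  set D := √(((d : ℝ) + 2) / (M.q * (1 - M.q)))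
  have hD2 : D ^ 2 = ((d : ℝ) + 2) / (M.q * (1 - M.q)) := Real.sq_sqrt (by positivity)
  have hD : 0 < D := Real.sqrt_pos.2 (by positivity)
  have hτ : 0 < π.τ := (mul_pos hκ₁ hD).trans_le hτ₁
  have hlen := FairPricing.tendsto_explorationLength hτ
  have hscale : Tendsto (fun T : ℕ => π.τ * √(T : ℝ)) atTop atTop :=
    (Real.tendsto_sqrt_atTop.comp tendsto_natCast_atTop_atTop).const_mul_atTop hτ
  have hgood : ∀ᶠ n : ℕ in atTop, ∀ i, n ≤ i → err i ≤ (M.C₀ - M.δ) / 2 :=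
    eventually_forall_ge_atTop.2 (hG.err_tendsto.eventually_le_const (by linarith))
  -- All asymptotic conditions are conditions on the exploration length, which tends to infinity
  -- with `T`; the resulting threshold depends on the instance, as `c₁` may.
  obtain ⟨T₁, hT₁⟩ := eventually_atTop.1 ((hscale.eventually_ge_atTop 1).and
    ((hlen.eventually hgood).and ((hlen.eventually (hreg.eventually_margin hcδ)).and
      (hlen.eventually_gt_atTop 0))))
  refine ⟨T₁ + 1, by positivity, fun T hT => ⟨fun i _ => FairPricing.integrable_instRegret hM hb hB
    hamin hbmax hxmax hδ' hest hL hopt T i, ?_⟩⟩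
  have hTT₁ : T₁ ≤ T := by
    have : (T₁ : ℝ) ≤ T := by linarith
    exact_mod_cast this
  obtain ⟨hone, herr, hmargin, hpos⟩ := hT₁ T hTT₁
  have hTpos : (0 : ℝ) < T := by linarith [(Nat.cast_nonneg T₁ : (0 : ℝ) ≤ T₁)]
  have hn : (0 : ℝ) < π.T₀ T := Nat.cast_pos.2 hpos
  have hη : ∀ i, 0 ≤ 4 * R * M.q * η i := fun i =>
    mul_nonneg (by positivity) (hG.level i).1.le
  have hphases := FairPricing.sum_range_le_of_phases (n := π.T₀ T) (T := T)
    (f := fun i => ∫ ω, FairPricing.instRegret M π L pstar T i ω ∂μ)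
    (g := fun i => 4 * R * M.q * η i) (a := 2 * R)
    (b := K * E / (π.T₀ T * (M.q * (1 - M.q))) + amax / π.T₀ T)
    (by positivity) (by positivity) hη
    (fun i _ _ => by
      have hint := FairPricing.integrable_instRegret hM hb hB hamin hbmax hxmax hδ' hest hL hopt T i
      have := integral_mono_ae hint (integrable_const (2 * R)) (by
        filter_upwards [FairPricing.abs_instRegret_le hM hb hB hamin hbmax hxmax hδ' hest hopt T i]
          with ω hω
        rw [hMδ] at hω
        exact (le_abs_self _).trans hω)
      simpa using this)
    (fun i hiT hi => by
      have h := FairPricing.integral_instRegret_le hM hb he hB hlam hamin hamax hbmax hxmax hδ' hest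
        hL hG hcδ hopt hpos hi hiT (herr i hi)
      have hm := mul_le_mul_of_nonneg_left ((le_div_iff₀ hn).2 hmargin) hamax.le
      rw [mul_one_div] at hm
      rw [hMδ] at h hm
      linarith)
  have hlengths : _ ≤ A * (D * √(T : ℝ)) := FairPricing.phase_lengths_le (κ₂ := κ₂) (n := (π.T₀ T : ℝ)) (r := 2 * R) (k := K * E) (a := amax)
    hκ₁ hD hTpos (by positivity) (by positivity) hamax.le hw hw1
    (by rw [hD2]; gcongr; linarith) hτ₁ hτ₂ hone (Nat.le_ceil _) (Nat.ceil_lt_add_one (by linarith)).le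
  -- Squaring reduces this to `A² (d + 2) < A² (d + 2) + 1`.
  have hroot : A * (D * √(T : ℝ))
      < √((A ^ 2 * ((d : ℝ) + 2) + 1) / (M.q * (1 - M.q)) * (T : ℝ)) := by
    refine Real.lt_sqrt_of_sq_lt ?_
    rw [mul_pow, mul_pow, hD2, Real.sq_sqrt hTpos.le, ← mul_assoc, ← mul_div_assoc]
    gcongr
    linarith
  have hH : ∑ t ∈ Finset.Icc 1 T, η (t - 1) = ∑ i ∈ Finset.range T, η i := by
    rw [← Finset.Ico_add_one_right_eq_Icc, Finset.sum_Ico_eq_sum_range]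
    simp
  have hηsum : 0 ≤ ∑ i ∈ Finset.range T, η i := Finset.sum_nonneg fun i _ => (hG.level i).1.le
  rw [← Finset.mul_sum] at hphases
  rw [hH, FairPricing.regret]
  linarith
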